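/- Let $(\mathcal X,d,\mu)$ be a space of homogeneous type: a metric space with a regular Borel measure $\mu$ such that every ball $B(x,r)=\{y:\ d(x,y)<r\}$, $r>0$, has positive and finite measure, and $\mu(B(x,2r))\le A_1\,\mu(B(x,r))$ for all $x\in\mathcal X$ and $r>0$, with a constant $A_1\ge 1$. Let $\mathcal D$ be a collection of balls in $\mathcal X$ (a ball being given by its center and radius). All functions are complex valued and measurable. For $\alpha>0$, $\mathrm{Lip}_{\mathcal D}(\alpha;\mathcal X)$ is the space of functions $f$ for which there is $C\ge 0$ such that $|f(x)-f(y)|\le C[\mu(B)]^\alpha$ for all balls $B\notin\mathcal D$ and all $x,y\in B$, and $\|f\|_{L^\infty(B)}\le C[\mu(B)]^\alpha$ for all $B\in\mathcal D$; its (semi)norm is the least such $C$, and $(\mathrm{Lip}_{\mathcal D}(\alpha;\mathcal X))^*$ is the space of bounded linear functionals on it, with the operator norm. Let $p\in(0,1]$ and $q\in[1,\infty]\cap(p,\infty]$ (with $1/\infty=0$). A $(p,q)$-atom is a function $a$ that vanishes outside some ball $B$ and satisfies $\int_{\mathcal X}a\,d\mu=0$ and $\|a\|_{L^q(\mathcal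 X)}\le[\mu(B)]^{1/q-1/p}$. A $(p,q)_{\mathcal D}$-atom is a function $b$ that vanishes outside some ball $B\in\mathcal D$ and satisfies $\|b\|_{L^q(\mathcal X)}\le[\mu(B)]^{1/q-1/p}$. The localized atomic Hardy space $H^{p,q}_{\mathcal D}(\mathcal X)$ is the set of all $f\in L^1(\mathcal X)$ if $p=1$, respectively of all $f\in(\mathrm{Lip}_{\mathcal D}(1/p-1;\mathcal X))^*$ if $p<1$, that can be written as $$f=\sum_{j\in\mathbb N}\lambda_ja_j+\sum_{k\in\mathbb N}\nu_kb_k,\qquad \sum_{j\in\mathbb N}|\lambda_j|^p+\sum_{k\in\mathbb N}|\nu_k|^p<\infty,$$ where $\lambda_j,\nu_k\in\mathbb C$, each $a_j$ is a $(p,q)$-atom or $0$, each $b_k$ is a $(p,q)_{\mathcal D}$-atom or $0$, and the series converges in the norm of $L^1(\mathcal X)$ if $p=1$, respectively of $(\mathrm{Lip}_{\mathcal D}(1/p-1;\mathcal X))^*$ if $p<1$ (an atom $a$ acting as the functional $g\mapsto\int_{\mathcal X}a\,g\,d\mu$). Put $$\|f\|_{H^{p,q}_{\mathcal D}(\mathcal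 X)}=\inf\Big(\sum_{j}|\lambda_j|^p+\sum_{k}|\nu_k|^p\Big)^{1/p},$$ the infimum being taken over all such decompositions of $f$. **Lemma 2.5.** Let $p\in(0,1]$ and $q\in[1,\infty)\cap(p,\infty)$. Then $H^{p,q}_{\mathcal D}(\mathcal X)=H^{p,\infty}_{\mathcal D}(\mathcal X)$ with equivalent norms, i.e. the two sets coincide and there is a constant $C>0$ such that for all $f$ in this set $$\|f\|_{H^{p,q}_{\mathcal D}(\mathcal X)}\le C\|f\|_{H^{p,\infty}_{\mathcal D}(\mathcal X)}\quad\text{and}\quad \|f\|_{H^{p,\infty}_{\mathcal D}(\mathcal X)}\le C\|f\|_{H^{p,q}_{\mathcal D}(\mathcal X)}.$$ -/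

import Mathlib

open MeasureTheory Filter Topology
open scoped ENNReal NNReal

noncomputable section

namespace LocalizedHardy

/-- A ball of a metric space, given by its center and its positive radius. -/
structure MetricBall (X : Type*) where
  center : X
  radius : ℝ
  radius_pos : 0 < radius

/-- The open ball `{y : d(y, center) < radius}` as a set of points. -/
def MetricBall.toSet {X : Type*} [MetricSpace X] (B : MetricBall X) : Set X :=
  Metric.ball B.center B.radius

/-- `(X, d, μ)` is a space of homogeneous type: balls have positive and finite measure and `μ` is
doubling. (Such a space is separable and `μ` is a locally finite Borel measure, so `μ` is
automatically outer regular and inner regular with respect to closed sets.) -/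
structure IsSpaceOfHomogeneousType {X : Type*} [MetricSpace X] [MeasurableSpace X]
    (μ : Measure X) : Prop where
  measure_ball_pos : ∀ (x : X) (r : ℝ), 0 < r → 0 < μ (Metric.ball x r)
  measure_ball_lt_top : ∀ (x : X) (r : ℝ), 0 < r → μ (Metric.ball x r) < ∞
  doubling : ∃ A : ℝ≥0, 1 ≤ A ∧ ∀ (x : X) (r : ℝ), 0 < r →
    μ (Metric.ball x (2 * r)) ≤ A * μ (Metric.ball x r)

section Lipschitz

variable {X : Type*} [MetricSpace X] [MeasurableSpace X]

/-- `C` is an admissible constant for `f` in the definition of the localized Lipschitz space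
`Lip_D(α; X)`: `|f x - f y| ≤ C μ(B)^α` whenever `x, y` lie in a ball `B ∉ D`, and
`‖f‖_{L^∞(B)} ≤ C μ(B)^α` for every ball `B ∈ D`. -/
structure IsLipBound (μ : Measure X) (D : Set (MetricBall X)) (α : ℝ) (f : X → ℂ) (C : ℝ) :
    Prop where
  nonneg : 0 ≤ C
  osc : ∀ B : MetricBall X, B ∉ D → ∀ x ∈ B.toSet, ∀ y ∈ B.toSet,
    ‖f x - f y‖ ≤ C * μ.real B.toSet ^ α
  bdd : ∀ B ∈ D, eLpNorm f ∞ (μ.restrict B.toSet) ≤ ENNReal.ofReal (C * μ.real B.toSet ^ α)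

theorem IsLipBound.zero (μ : Measure X) (D : Set (MetricBall X)) (α : ℝ) :
    IsLipBound μ D α 0 0 :=
  ⟨le_rfl, fun _ _ _ _ _ _ => by simp, fun _ _ => by simp⟩

theorem IsLipBound.add {μ : Measure X} {D : Set (MetricBall X)} {α : ℝ} {f g : X → ℂ} {C C' : ℝ}
    (hfm : AEStronglyMeasurable f μ) (hgm : AEStronglyMeasurable g μ)
    (hf : IsLipBound μ D α f C) (hg : IsLipBound μ D α g C') :
    IsLipBound μ D α (f + g) (C + C') := by
  refine ⟨add_nonneg hf.nonneg hg.nonneg, fun B hB x hx y hy => ?_, fun B hB => ?_⟩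
  · have h : (f + g) x - (f + g) y = (f x - f y) + (g x - g y) := by
      simp only [Pi.add_apply]; ring
    rw [h, add_mul]
    exact (norm_add_le _ _).trans (add_le_add (hf.osc B hB x hx y hy) (hg.osc B hB x hx y hy))
  · have h0 : (0 : ℝ) ≤ μ.real B.toSet ^ α := Real.rpow_nonneg measureReal_nonneg _
    rw [add_mul, ENNReal.ofReal_add (mul_nonneg hf.nonneg h0) (mul_nonneg hg.nonneg h0)]
    exact (eLpNorm_add_le hfm.restrict hgm.restrict le_top).trans
      (add_le_add (hf.bdd B hB) (hg.bdd B hB))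

theorem IsLipBound.smul {μ : Measure X} {D : Set (MetricBall X)} {α : ℝ} {f : X → ℂ} {C : ℝ}
    (c : ℂ) (hf : IsLipBound μ D α f C) : IsLipBound μ D α (c • f) (‖c‖ * C) := by
  refine ⟨mul_nonneg (norm_nonneg _) hf.nonneg, fun B hB x hx y hy => ?_, fun B hB => ?_⟩
  · have h : (c • f) x - (c • f) y = c * (f x - f y) := by
      simp only [Pi.smul_apply, smul_eq_mul]; ring
    rw [h, norm_mul, mul_assoc]
    exact mul_le_mul_of_nonneg_left (hf.osc B hB x hx y hy) (norm_nonneg _)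
  · rw [eLpNorm_const_smul, mul_assoc, ENNReal.ofReal_mul (norm_nonneg _), ofReal_norm]
    exact mul_le_mul_right (hf.bdd B hB) _

/-- The measurable functions in the localized Lipschitz space `Lip_D(α; X)`, as a vector space. -/
def lipSubmodule (μ : Measure X) (D : Set (MetricBall X)) (α : ℝ) : Submodule ℂ (X → ℂ) where
  carrier := {f | AEStronglyMeasurable f μ ∧ ∃ C, IsLipBound μ D α f C}
  zero_mem' := ⟨aestronglyMeasurable_zero, 0, IsLipBound.zero μ D α⟩
  add_mem' := fun ⟨hf, C, hC⟩ ⟨hg, C', hC'⟩ => ⟨hf.add hg, C + C', hC.add hf hg hC'⟩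
  smul_mem' := fun c _ ⟨hf, C, hC⟩ => ⟨hf.const_smul c, ‖c‖ * C, hC.smul c⟩

/-- The (semi)norm of `Lip_D(α; X)`: the least admissible constant. -/
def lipSeminorm (μ : Measure X) (D : Set (MetricBall X)) (α : ℝ) :
    Seminorm ℂ (lipSubmodule μ D α) :=
  have bdd : ∀ f : X → ℂ, BddBelow {C | IsLipBound μ D α f C} :=
    fun _ => ⟨0, fun _ hC => IsLipBound.nonneg hC⟩
  Seminorm.ofSMulLE (fun f => sInf {C : ℝ | IsLipBound μ D α f.1 C})
    (le_antisymm (csInf_le (bdd _) (IsLipBound.zero μ D α))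
      (Real.sInf_nonneg fun _ hC => IsLipBound.nonneg hC))
    (fun f g => by
      have hf : {C : ℝ | IsLipBound μ D α f.1 C}.Nonempty := f.2.2
      have hg : {C : ℝ | IsLipBound μ D α g.1 C}.Nonempty := g.2.2
      rw [← csInf_add hf (bdd _) hg (bdd _)]
      refine csInf_le_csInf (bdd _) (Set.Nonempty.add hf hg) ?_
      rintro _ ⟨C, hC, C', hC', rfl⟩
      exact IsLipBound.add f.2.1 g.2.1 hC hC')
    (fun c f => by
      have hf : {C : ℝ | IsLipBound μ D α f.1 C}.Nonempty := f.2.2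
      have h := Real.sInf_smul_of_nonneg (norm_nonneg c) {C : ℝ | IsLipBound μ D α f.1 C}
      rw [smul_eq_mul] at h
      rw [← h]
      refine csInf_le_csInf (bdd _) (Set.Nonempty.smul_set hf) ?_
      rintro _ ⟨C, hC, rfl⟩
      exact IsLipBound.smul c hC)

/-- The localized Lipschitz space `Lip_D(α; X)`, with the topology of its seminorm. -/
def LipD (μ : Measure X) (D : Set (MetricBall X)) (α : ℝ) : Type _ := ↥(lipSubmodule μ D α)

/-- The function underlying an element of `Lip_D(α; X)`. -/
def LipD.toFun {μ : Measure X} {D : Set (MetricBall X)} {α : ℝ} (f : LipD μ D α) : X → ℂ :=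
  Subtype.val (p := fun f => f ∈ lipSubmodule μ D α) f

instance LipD.instSeminormedAddCommGroup (μ : Measure X) (D : Set (MetricBall X)) (α : ℝ) :
    SeminormedAddCommGroup (LipD μ D α) :=
  (lipSeminorm μ D α).toAddGroupSeminorm.toSeminormedAddCommGroup

instance LipD.instNormedSpace (μ : Measure X) (D : Set (MetricBall X)) (α : ℝ) :
    NormedSpace ℂ (LipD μ D α) where
  toModule := inferInstanceAs (Module ℂ ↥(lipSubmodule μ D α))
  norm_smul_le c f := (map_smul_eq_mul (lipSeminorm μ D α) c f).le

/-- The norm is the least admissible constant. -/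
theorem LipD.norm_def {μ : Measure X} {D : Set (MetricBall X)} {α : ℝ} (f : LipD μ D α) :
    ‖f‖ = sInf {C : ℝ | IsLipBound μ D α f.toFun C} :=
  rfl

end Lipschitz

section Hardy

variable {X : Type*} [MetricSpace X] [MeasurableSpace X]

/-- `a` is a measurable function that vanishes outside the ball `B` and satisfies
`‖a‖_{L^q(X)} ≤ μ(B)^{1/q - 1/p}` (where `1/∞ = 0`). -/
structure IsSizedOn (μ : Measure X) (p : ℝ) (q : ℝ≥0∞) (a : X → ℂ) (B : MetricBall X) :
    Prop where
  aestronglyMeasurable : AEStronglyMeasurable a μ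
  support_subset : Function.support a ⊆ B.toSet
  eLpNorm_le : eLpNorm a q μ ≤ μ B.toSet ^ ((q⁻¹).toReal - 1 / p)

/-- `(p, q)`-atoms. -/
def IsAtom (μ : Measure X) (p : ℝ) (q : ℝ≥0∞) (a : X → ℂ) : Prop :=
  ∃ B : MetricBall X, IsSizedOn μ p q a B ∧ ∫ x, a x ∂μ = 0

/-- `(p, q)_D`-atoms. -/
def IsLocalAtom (μ : Measure X) (D : Set (MetricBall X)) (p : ℝ) (q : ℝ≥0∞) (b : X → ℂ) : Prop :=
  ∃ B ∈ D, IsSizedOn μ p q b B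

/-- `f = ∑ λ_j a_j + ∑ ν_k b_k` with `(p, q)`-atoms `a_j`, `(p, q)_D`-atoms `b_k` and
`∑ |λ_j|^p + ∑ |ν_k|^p < ∞`, the series converging in the norm of the ambient space `E`. The
relation `R a S` says that the element `S` of `E` is the one given by the function `a`. The zero
function is always allowed as a term, so that finite or empty sums are included (this matters
only if there is no ball in `D`). -/
def IsAtomicDecomposition {E : Type*} [SeminormedAddCommGroup E] [NormedSpace ℂ E]
    (R : (X → ℂ) → E → Prop) (μ : Measure X) (D : Set (MetricBall X)) (p : ℝ) (q : ℝ≥0∞)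
    (f : E) (lam nu : ℕ → ℂ) : Prop :=
  Summable (fun j => ‖lam j‖ ^ p) ∧ Summable (fun k => ‖nu k‖ ^ p) ∧
  ∃ (a b : ℕ → X → ℂ) (S T : ℕ → E),
    (∀ j, (IsAtom μ p q (a j) ∨ a j = 0) ∧ R (a j) (S j)) ∧
    (∀ k, (IsLocalAtom μ D p q (b k) ∨ b k = 0) ∧ R (b k) (T k)) ∧
    Tendsto (fun N => ∑ j ∈ Finset.range N, lam j • S j + ∑ k ∈ Finset.range N, nu k • T k)
      atTop (𝓝 f)

/-- The elements of the ambient space `E` that have an atomic decomposition. -/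
def atomicSpace {E : Type*} [SeminormedAddCommGroup E] [NormedSpace ℂ E]
    (R : (X → ℂ) → E → Prop) (μ : Measure X) (D : Set (MetricBall X)) (p : ℝ) (q : ℝ≥0∞) :
    Set E :=
  {f | ∃ lam nu : ℕ → ℂ, IsAtomicDecomposition R μ D p q f lam nu}

/-- The infimum of `(∑ |λ_j|^p + ∑ |ν_k|^p)^{1/p}` over all atomic decompositions of `f`. -/
def atomicNorm {E : Type*} [SeminormedAddCommGroup E] [NormedSpace ℂ E]
    (R : (X → ℂ) → E → Prop) (μ : Measure X) (D : Set (MetricBall X)) (p : ℝ) (q : ℝ≥0∞)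
    (f : E) : ℝ :=
  sInf {t : ℝ | ∃ lam nu : ℕ → ℂ, IsAtomicDecomposition R μ D p q f lam nu ∧
    t = (∑' j, ‖lam j‖ ^ p + ∑' k, ‖nu k‖ ^ p) ^ (1 / p)}

/-- `S` is the class of `a` in `L¹(X)`. -/
def RepresentsL1 (μ : Measure X) (a : X → ℂ) (S : Lp ℂ 1 μ) : Prop :=
  (S : X → ℂ) =ᵐ[μ] a

/-- `S` is the functional `g ↦ ∫ a g dμ` on `Lip_D(α; X)`. -/
def RepresentsDual (μ : Measure X) (D : Set (MetricBall X)) (α : ℝ) (a : X → ℂ)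
    (S : StrongDual ℂ (LipD μ D α)) : Prop :=
  ∀ g : LipD μ D α, S g = ∫ x, a x * g.toFun x ∂μ

/-- The space `H^{1,q}_D(X)`, inside `L¹(X)`. -/
def hardyOne (μ : Measure X) (D : Set (MetricBall X)) (q : ℝ≥0∞) : Set (Lp ℂ 1 μ) :=
  atomicSpace (RepresentsL1 μ) μ D 1 q

/-- The norm of `H^{1,q}_D(X)`. -/
def hardyOneNorm (μ : Measure X) (D : Set (MetricBall X)) (q : ℝ≥0∞) (f : Lp ℂ 1 μ) : ℝ :=
  atomicNorm (RepresentsL1 μ) μ D 1 q f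

/-- The space `H^{p,q}_D(X)` for `p < 1`, inside the dual space of `Lip_D(1/p - 1; X)`. -/
def hardyLT (μ : Measure X) (D : Set (MetricBall X)) (p : ℝ) (q : ℝ≥0∞) :
    Set (StrongDual ℂ (LipD μ D (1 / p - 1))) :=
  atomicSpace (RepresentsDual μ D (1 / p - 1)) μ D p q

/-- The (quasi-)norm of `H^{p,q}_D(X)` for `p < 1`. -/
def hardyLTNorm (μ : Measure X) (D : Set (MetricBall X)) (p : ℝ) (q : ℝ≥0∞)
    (f : StrongDual ℂ (LipD μ D (1 / p - 1))) : ℝ :=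
  atomicNorm (RepresentsDual μ D (1 / p - 1)) μ D p q f

end Hardy

end LocalizedHardy

end

/-! A `(p, ∞)`-atom is a `(p, q)`-atom by Hölder's inequality on its ball, so only the passage from
`q` to `∞` has content. It rests on a splitting that is then iterated.

Let `a` be a mean-zero function on a ball `B₀`, of the size of a `(p, q)`-atom up to a factor 2. Its
Calderón–Zygmund decomposition (`exists_calderonZygmund`) at `N` times the bound for its `L^q` mean
reads `a = g + ∑ h_i`. Here `g` is bounded, and each `h_i` has mean zero, lives on a ball `B_i` and
has `L^q` mean at most a constant times `N μ(B₀)^{-1/p}`. So `g` is a multiple of a `(p, ∞)`-atom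
and the `h_i` are multiples of `(p, q)`-atoms. The stopping condition for `|a|^q` gives `∑ μ(B_i) ≤
C N^{-q} μ(B₀)`, so the `p`-th powers of the coefficients of the `h_i` add up to at most `C
N^{p-q}`. Since `p < q`, this is at most `1/2` for large `N`. For a local atom, the mean times the
indicator of the ball is subtracted beforehand; that term is itself a local `(p, ∞)`-atom
(`exists_split`).

Applying the splitting to every term of a decomposition, then to the remainder, and so on, halves
the sum of `p`-th powers at each stage. The remainders tend to `0` in norm, and the extracted `(p,
∞)`-parts form a geometric series (`HasDecomp.of_forall_split`).

Atoms have norm at most 1 in the ambient space and `p ≤ 1`, so all series converge absolutely and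
can be rearranged. The few facts needed about `L¹` and about the dual of the Lipschitz space are
collected in `IsRealization`, so that one argument serves `p = 1` and `p < 1`. -/

noncomputable section

namespace LocalizedHardy

universe u

/-! ### Power sums with exponent `p ≤ 1`. -/

section PowerSums

/-- For `p ≤ 1` each term is controlled by its `p`-th power and the `p`-th power sum. -/
theorem le_mul_of_tsum_rpow_le {ι : Type*} {u : ι → ℝ} {p t : ℝ} (hp0 : 0 < p) (hp1 : p ≤ 1)
    (hu : ∀ i, 0 ≤ u i) (hs : Summable fun i => u i ^ p) (ht : ∑' i, u i ^ p ≤ t) (i : ι) :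
    u i ≤ u i ^ p * t ^ (1 / p - 1) := by
  have h1 : u i ^ p ≤ t :=
    (hs.le_tsum i fun j _ => Real.rpow_nonneg (hu j) _).trans ht
  have h2 : u i = u i ^ p * (u i ^ p) ^ (1 / p - 1) := by
    rcases (hu i).eq_or_lt with h | h
    · rw [← h, Real.zero_rpow hp0.ne', zero_mul]
    · rw [← Real.rpow_mul h.le, ← Real.rpow_add h, mul_sub, mul_one_div_cancel hp0.ne']
      simp
  have h3 : 0 ≤ 1 / p - 1 := by
    rw [sub_nonneg, le_div_iff₀ hp0]; linarith
  calc u i = u i ^ p * (u i ^ p) ^ (1 / p - 1) := h2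
    _ ≤ u i ^ p * t ^ (1 / p - 1) := by
      have := Real.rpow_nonneg (hu i) p
      gcongr

theorem summable_of_summable_rpow {ι : Type*} {u : ι → ℝ} {p : ℝ} (hp0 : 0 < p) (hp1 : p ≤ 1)
    (hu : ∀ i, 0 ≤ u i) (hs : Summable fun i => u i ^ p) : Summable u :=
  Summable.of_nonneg_of_le hu (fun i => le_mul_of_tsum_rpow_le hp0 hp1 hu hs le_rfl i)
    (hs.mul_right _)

theorem tsum_le_rpow_of_tsum_rpow_le {ι : Type*} {u : ι → ℝ} {p t : ℝ} (hp0 : 0 < p)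
    (hp1 : p ≤ 1) (hu : ∀ i, 0 ≤ u i) (hs : Summable fun i => u i ^ p)
    (ht : ∑' i, u i ^ p ≤ t) : ∑' i, u i ≤ t ^ (1 / p) := by
  have ht0 : 0 ≤ t := (tsum_nonneg fun i => Real.rpow_nonneg (hu i) p).trans ht
  calc ∑' i, u i ≤ ∑' i, u i ^ p * t ^ (1 / p - 1) :=
        (summable_of_summable_rpow hp0 hp1 hu hs).tsum_le_tsum
          (fun i => le_mul_of_tsum_rpow_le hp0 hp1 hu hs ht i) (hs.mul_right _)
    _ = (∑' i, u i ^ p) * t ^ (1 / p - 1) := tsum_mul_right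
    _ ≤ t * t ^ (1 / p - 1) := by gcongr
    _ = t ^ (1 / p) := by
      rcases ht0.eq_or_lt with h | h
      · rw [← h, zero_mul, Real.zero_rpow (by positivity)]
      · nth_rewrite 1 [← Real.rpow_one t]
        rw [← Real.rpow_add h]; congr 1; ring

end PowerSums

/-! ### Abstract atomic series and the iteration of a splitting. -/

section Decomposition

variable {X E : Type*} [SeminormedAddCommGroup E] [NormedSpace ℂ E]

/-- `f = ∑ λ_j a_j` in `E`, where every `a_j` belongs to the class `P` and `∑ |λ_j|^p ≤ t`. -/
def HasDecomp (R : (X → ℂ) → E → Prop) (P : (X → ℂ) → Prop) (p : ℝ) (f : E) (t : ℝ) : Prop :=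
  ∃ (lam : ℕ → ℂ) (a : ℕ → X → ℂ) (S : ℕ → E), (∀ j, P (a j) ∧ R (a j) (S j)) ∧
    (Summable fun j => ‖lam j‖ ^ p) ∧ ∑' j, ‖lam j‖ ^ p ≤ t ∧ HasSum (fun j => lam j • S j) f

variable {R : (X → ℂ) → E → Prop} {P Q : (X → ℂ) → Prop} {p : ℝ}

theorem HasDecomp.mono {f : E} {t t' : ℝ} (h : HasDecomp R P p f t) (ht : t ≤ t') :
    HasDecomp R P p f t' := by
  obtain ⟨lam, a, S, h1, h2, h3, h4⟩ := h
  exact ⟨lam, a, S, h1, h2, h3.trans ht, h4⟩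

/-- An injection into `ℕ` reindexes the series, and the unused places receive coefficient and
function `0`; `p > 0` makes `0 ^ p = 0`, so they cost nothing. -/
theorem HasDecomp.of_countable {ι : Type*} [Countable ι] (hp0 : 0 < p) (hP0 : P 0) (hR0 : R 0 0)
    {f : E} {t : ℝ} (lam : ι → ℂ) (a : ι → X → ℂ) (S : ι → E) (h : ∀ j, P (a j) ∧ R (a j) (S j))
    (hs : Summable fun j => ‖lam j‖ ^ p) (ht : ∑' j, ‖lam j‖ ^ p ≤ t)
    (hf : HasSum (fun j => lam j • S j) f) : HasDecomp R P p f t := by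
  obtain ⟨e, he⟩ := exists_injective_nat ι
  have hext : (fun n => ‖Function.extend e lam 0 n‖ ^ p)
      = Function.extend e (fun j => ‖lam j‖ ^ p) 0 := by
    funext n
    by_cases hn : ∃ j, e j = n
    · obtain ⟨j, rfl⟩ := hn
      simp [he.extend_apply]
    · simp [Function.extend_apply' _ _ _ hn, Real.zero_rpow hp0.ne']
  have hsum : HasSum (fun n => ‖Function.extend e lam 0 n‖ ^ p) (∑' j, ‖lam j‖ ^ p) := by
    rw [hext, hasSum_extend_zero he]
    exact hs.hasSum
  refine ⟨Function.extend e lam 0, Function.extend e a 0, Function.extend e S 0, fun n => ?_,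
    hsum.summable, hsum.tsum_eq.le.trans ht, ?_⟩
  · by_cases hn : ∃ j, e j = n
    · obtain ⟨j, rfl⟩ := hn
      simpa [he.extend_apply] using h j
    · simpa [Function.extend_apply' _ _ _ hn] using ⟨hP0, hR0⟩
  · rw [← hasSum_extend_zero he] at hf
    convert hf using 1
    funext n
    by_cases hn : ∃ j, e j = n
    · obtain ⟨j, rfl⟩ := hn
      simp [he.extend_apply]
    · simp [Function.extend_apply' _ _ _ hn]

theorem HasDecomp.norm_le (hp0 : 0 < p) (hp1 : p ≤ 1)
    (hPR : ∀ a S, P a → R a S → ‖S‖ ≤ 1) {f : E} {t : ℝ} (h : HasDecomp R P p f t) :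
    ‖f‖ ≤ t ^ (1 / p) := by
  obtain ⟨lam, a, S, h1, h2, h3, h4⟩ := h
  have hsum := summable_of_summable_rpow hp0 hp1 (fun j => norm_nonneg (lam j)) h2
  have hle : ∀ j, ‖lam j • S j‖ ≤ ‖lam j‖ := fun j => by
    rw [norm_smul]
    exact mul_le_of_le_one_right (norm_nonneg _) (hPR _ _ (h1 j).1 (h1 j).2)
  refine (le_of_tendsto' h4.norm fun s => (norm_sum_le _ _).trans ?_).trans
    (tsum_le_rpow_of_tsum_rpow_le hp0 hp1 (fun j => norm_nonneg (lam j)) h2 h3)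
  exact (Finset.sum_le_sum fun j _ => hle j).trans
    (hsum.sum_le_tsum _ fun j _ => norm_nonneg _)

theorem HasDecomp.of_atom (hp0 : 0 < p) (hP0 : P 0) (hR0 : R 0 0) {a : X → ℂ} {S : E}
    (ha : P a) (haS : R a S) (c : ℂ) : HasDecomp R P p (c • S) (‖c‖ ^ p) := by
  refine HasDecomp.of_countable hp0 hP0 hR0 (ι := Unit) (fun _ => c) (fun _ => a) (fun _ => S)
    (fun _ => ⟨ha, haS⟩) (Summable.of_finite) ?_ ?_
  · simp
  · simp

variable [CompleteSpace E]

/-- Sizes are measured by `p`-th powers, so they add with weights `‖c i‖ ^ p`. The double family is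
absolutely summable in `E` because `p ≤ 1` and its members have norm at most 1, which permits
merging it into one series. -/
theorem HasDecomp.sum {ι : Type*} [Countable ι] (hp0 : 0 < p) (hp1 : p ≤ 1)
    (hP0 : P 0) (hR0 : R 0 0) (hPR : ∀ a S, P a → R a S → ‖S‖ ≤ 1) [T2Space E] {f : E}
    {c : ι → ℂ} {F : ι → E} {t : ι → ℝ} (hF : ∀ i, HasDecomp R P p (F i) (t i))
    (hs : Summable fun i => ‖c i‖ ^ p * t i) (hf : HasSum (fun i => c i • F i) f) :
    HasDecomp R P p f (∑' i, ‖c i‖ ^ p * t i) := by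
  choose lam a S h1 h2 h3 h4 using hF
  have hnn : ∀ x : ι × ℕ, 0 ≤ ‖c x.1 * lam x.1 x.2‖ ^ p := fun x =>
    Real.rpow_nonneg (norm_nonneg _) _
  have hmul : ∀ i j, ‖c i * lam i j‖ ^ p = ‖c i‖ ^ p * ‖lam i j‖ ^ p := fun i j => by
    rw [norm_mul, Real.mul_rpow (norm_nonneg _) (norm_nonneg _)]
  have hin : ∀ i, Summable fun j => ‖c i * lam i j‖ ^ p := fun i => by
    simp only [hmul]
    exact (h2 i).mul_left _
  have hle : ∀ i, ∑' j, ‖c i * lam i j‖ ^ p ≤ ‖c i‖ ^ p * t i := fun i => by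
    simp only [hmul, tsum_mul_left]
    exact mul_le_mul_of_nonneg_left (h3 i) (Real.rpow_nonneg (norm_nonneg _) _)
  have hout : Summable fun i => ∑' j, ‖c i * lam i j‖ ^ p :=
    Summable.of_nonneg_of_le (fun i => tsum_nonneg fun j => hnn (i, j)) hle hs
  have hdbl : Summable fun x : ι × ℕ => ‖c x.1 * lam x.1 x.2‖ ^ p :=
    (summable_prod_of_nonneg hnn).2 ⟨hin, hout⟩
  have hE : Summable fun x : ι × ℕ => (c x.1 * lam x.1 x.2) • S x.1 x.2 := by
    refine Summable.of_norm_bounded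
      (summable_of_summable_rpow hp0 hp1 (fun x => norm_nonneg _) hdbl) fun x => ?_
    rw [norm_smul]
    exact mul_le_of_le_one_right (norm_nonneg _) (hPR _ _ (h1 _ _).1 (h1 _ _).2)
  have hE2 : HasSum (fun i => c i • F i) (∑' x : ι × ℕ, (c x.1 * lam x.1 x.2) • S x.1 x.2) := by
    refine hE.hasSum.prod_fiberwise fun i => ?_
    simpa only [mul_smul] using (h4 i).const_smul (c i)
  refine HasDecomp.of_countable hp0 hP0 hR0 (fun x : ι × ℕ => c x.1 * lam x.1 x.2)
    (fun x => a x.1 x.2) (fun x => S x.1 x.2) (fun x => h1 x.1 x.2) hdbl ?_ ?_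
  · rw [hdbl.tsum_prod' hin]
    exact hout.tsum_le_tsum hle hs
  · rw [hf.unique hE2]
    exact hE.hasSum

theorem HasDecomp.add [T2Space E] (hp0 : 0 < p) (hp1 : p ≤ 1)
    (hP0 : P 0) (hR0 : R 0 0) (hPR : ∀ a S, P a → R a S → ‖S‖ ≤ 1) {f g : E} {s t : ℝ}
    (hf : HasDecomp R P p f s) (hg : HasDecomp R P p g t) : HasDecomp R P p (f + g) (s + t) := by
  have := HasDecomp.sum (ι := Bool) (c := fun _ => 1) (F := fun b => cond b f g)
    (t := fun b => cond b s t) hp0 hp1 hP0 hR0 hPR (f := f + g) (by rintro (_ | _) <;> assumption)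
    Summable.of_finite (by simpa using hasSum_fintype (fun b => cond b f g))
  simpa using this

/-- If every term of class `P` splits into a part with a decomposition of class `Q` and a
remainder that has a decomposition of class `P` of half the size, then every decomposition of
class `P` can be replaced by one of class `Q`. -/
theorem HasDecomp.of_forall_split [T2Space E] (hp0 : 0 < p) (hp1 : p ≤ 1)
    (hP0 : P 0) (hQ0 : Q 0) (hR0 : R 0 0) (hPR : ∀ a S, P a → R a S → ‖S‖ ≤ 1)
    (hQR : ∀ a S, Q a → R a S → ‖S‖ ≤ 1) {K : ℝ} (hK : 0 ≤ K)
    (hsplit : ∀ a S, P a → R a S → ∃ S₁ S₂, S = S₁ + S₂ ∧ HasDecomp R Q p S₁ K ∧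
      HasDecomp R P p S₂ (1 / 2)) {f : E} {t : ℝ} (hf : HasDecomp R P p f t) :
    HasDecomp R Q p f (2 * K * t) := by
  have hstep : ∀ (f : E) (t : ℝ), HasDecomp R P p f t → ∃ f₁ f₂, f = f₁ + f₂ ∧
      HasDecomp R Q p f₁ (K * t) ∧ HasDecomp R P p f₂ (t / 2) := by
    rintro f t ⟨lam, a, S, h1, h2, h3, h4⟩
    choose S₁ S₂ hS hS₁ hS₂ using fun j => hsplit (a j) (S j) (h1 j).1 (h1 j).2
    -- Summing the split parts of all terms against `lam` multiplies the size by `k`; this is used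
    -- once for the extracted parts and once for the remainders.
    have key : ∀ (P' : (X → ℂ) → Prop) (_ : P' 0) (_ : ∀ a S, P' a → R a S → ‖S‖ ≤ 1)
        (T : ℕ → E) (k : ℝ) (_ : 0 ≤ k) (_ : ∀ j, HasDecomp R P' p (T j) k),
        Summable (fun j => lam j • T j) ∧ HasDecomp R P' p (∑' j, lam j • T j) (k * t) := by
      intro P' h0 hR T k hk hT
      have hsm : Summable (fun j => lam j • T j) := by
        refine Summable.of_norm_bounded (g := fun j => ‖lam j‖ * k ^ (1 / p))
          ((summable_of_summable_rpow hp0 hp1 (fun j => norm_nonneg (lam j)) h2).mul_right _)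
          fun j => ?_
        rw [norm_smul]
        exact mul_le_mul_of_nonneg_left ((hT j).norm_le hp0 hp1 hR) (norm_nonneg _)
      refine ⟨hsm, (HasDecomp.sum hp0 hp1 h0 hR0 hR hT (h2.mul_right k) hsm.hasSum).mono ?_⟩
      rw [tsum_mul_right, mul_comm]
      exact mul_le_mul_of_nonneg_left h3 hk
    obtain ⟨hs1, hd1⟩ := key Q hQ0 hQR S₁ K hK hS₁
    obtain ⟨hs2, hd2⟩ := key P hP0 hPR S₂ (1 / 2) (by norm_num) hS₂
    refine ⟨_, _, ?_, hd1, hd2.mono (by linarith)⟩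
    refine h4.unique ?_
    convert hs1.hasSum.add hs2.hasSum using 2 with j
    rw [hS j, smul_add]
  choose! F G hFG hF hG using hstep
  -- `g n` is the remainder after `n` splittings, of size at most `t / 2 ^ n`.
  let g : ℕ → E := fun n => Nat.rec f (fun n h => G h (t / 2 ^ n)) n
  have hg : ∀ n, HasDecomp R P p (g n) (t / 2 ^ n) := by
    intro n
    induction n with
    | zero => simpa [g] using hf
    | succ n ih =>
      have := hG _ _ ih
      rw [div_div, ← pow_succ] at this
      exact this
  have hgs : ∀ n, g n = F (g n) (t / 2 ^ n) + g (n + 1) := fun n => hFG _ _ (hg n)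
  have hFd : ∀ n, HasDecomp R Q p (F (g n) (t / 2 ^ n)) (K * (t / 2 ^ n)) := fun n =>
    hF _ _ (hg n)
  have hpart : ∀ N, ∑ n ∈ Finset.range N, F (g n) (t / 2 ^ n) = f - g N := by
    intro N
    induction N with
    | zero => simp [g]
    | succ N ih =>
      rw [Finset.sum_range_succ, ih]
      nth_rewrite 1 [hgs N]
      abel
  have ht0 : 0 ≤ t := by
    obtain ⟨lam, a, S, h1, h2, h3, h4⟩ := hf
    exact (tsum_nonneg fun j => Real.rpow_nonneg (norm_nonneg _) _).trans h3
  have hpow : ∀ n : ℕ, (t / 2 ^ n) ^ (1 / p) = t ^ (1 / p) * ((1 / 2 : ℝ) ^ (1 / p)) ^ n := by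
    intro n
    rw [Real.rpow_pow_comm (by norm_num), ← Real.mul_rpow ht0 (by positivity),
      one_div_pow, mul_one_div]
  have hr : (1 / 2 : ℝ) ^ (1 / p) < 1 :=
    Real.rpow_lt_one (by norm_num) (by norm_num) (by positivity)
  have hr0 : 0 ≤ (1 / 2 : ℝ) ^ (1 / p) := by positivity
  have hgeo : Summable fun n : ℕ => (t / 2 ^ n) ^ (1 / p) := by
    simp only [hpow]
    exact (summable_geometric_of_lt_one hr0 hr).mul_left _
  have hFs : Summable fun n => F (g n) (t / 2 ^ n) := by
    refine Summable.of_norm_bounded (hgeo.mul_left (K ^ (1 / p))) fun n => ?_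
    refine ((hFd n).norm_le hp0 hp1 hQR).trans_eq ?_
    rw [Real.mul_rpow hK (by positivity)]
  -- The norm of a remainder is at most its size to the power `1 / p`, which decays geometrically.
  have hg0 : Tendsto g atTop (𝓝 0) :=
    squeeze_zero_norm (fun n => (hg n).norm_le hp0 hp1 hPR) hgeo.tendsto_atTop_zero
  have hlim : Tendsto (fun N => ∑ n ∈ Finset.range N, F (g n) (t / 2 ^ n)) atTop (𝓝 f) := by
    simp only [hpart]
    simpa using tendsto_const_nhds.sub hg0
  have hsum : HasSum (fun n => F (g n) (t / 2 ^ n)) f := by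
    rw [← tendsto_nhds_unique hFs.hasSum.tendsto_sum_nat hlim]
    exact hFs.hasSum
  have h2 : HasSum (fun n : ℕ => K * (t / 2 ^ n)) (2 * K * t) := by
    have h := (hasSum_geometric_two' (K * t)).mul_left 2
    rw [← mul_assoc] at h
    have e : (fun n : ℕ => K * (t / 2 ^ n)) = fun n : ℕ => 2 * (K * t / 2 / 2 ^ n) := by
      funext n
      ring
    rwa [e]
  have := HasDecomp.sum (c := fun _ : ℕ => 1) hp0 hp1 hQ0 hR0 hQR hFd
    (by simpa using h2.summable) (by simpa using hsum)
  simpa [h2.tsum_eq] using this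

end Decomposition

/-! ### Spaces of homogeneous type and stopping-time balls. -/

section Geometry

variable {X : Type*} [MetricSpace X] [MeasurableSpace X] {μ : Measure X}

theorem IsSpaceOfHomogeneousType.measure_closedBall_lt_top (hμ : IsSpaceOfHomogeneousType μ)
    (x : X) (r : ℝ) : μ (Metric.closedBall x r) < ∞ := by
  refine (measure_mono ?_).trans_lt (hμ.measure_ball_lt_top x (|r| + 1) (by positivity))
  exact Metric.closedBall_subset_ball (by linarith [le_abs_self r])

theorem IsSpaceOfHomogeneousType.measure_closedBall_pos (hμ : IsSpaceOfHomogeneousType μ)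
    (x : X) {r : ℝ} (hr : 0 < r) : 0 < μ (Metric.closedBall x r) :=
  (hμ.measure_ball_pos x r hr).trans_le (measure_mono Metric.ball_subset_closedBall)

theorem measure_ball_two_pow_mul_le {A : ℝ≥0}
    (hA : ∀ (x : X) (r : ℝ), 0 < r → μ (Metric.ball x (2 * r)) ≤ A * μ (Metric.ball x r))
    (x : X) {r : ℝ} (hr : 0 < r) (n : ℕ) :
    μ (Metric.ball x (2 ^ n * r)) ≤ (A : ℝ≥0∞) ^ n * μ (Metric.ball x r) := by
  induction n with
  | zero => simp
  | succ n ih =>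
    rw [pow_succ', mul_assoc, pow_succ', mul_assoc]
    exact (hA x _ (by positivity)).trans (by gcongr)

theorem IsSpaceOfHomogeneousType.isUnifLocDoublingMeasure (hμ : IsSpaceOfHomogeneousType μ) :
    IsUnifLocDoublingMeasure μ := by
  obtain ⟨A, -, hA⟩ := hμ.doubling
  refine ⟨⟨A ^ 2, ?_⟩⟩
  filter_upwards [self_mem_nhdsWithin] with ε hε x
  have hε : 0 < ε := hε
  calc μ (Metric.closedBall x (2 * ε)) ≤ μ (Metric.ball x (2 ^ 2 * ε)) :=
        measure_mono (Metric.closedBall_subset_ball (by linarith))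
    _ ≤ (A : ℝ≥0∞) ^ 2 * μ (Metric.ball x ε) := measure_ball_two_pow_mul_le hA x hε 2
    _ ≤ ((A ^ 2 : ℝ≥0) : ℝ≥0∞) * μ (Metric.closedBall x ε) := by
      push_cast
      gcongr
      exact Metric.ball_subset_closedBall

theorem IsSpaceOfHomogeneousType.isLocallyFiniteMeasure (hμ : IsSpaceOfHomogeneousType μ) :
    IsLocallyFiniteMeasure μ :=
  ⟨fun x => ⟨_, Metric.ball_mem_nhds x one_pos, hμ.measure_ball_lt_top x 1 one_pos⟩⟩

theorem IsSpaceOfHomogeneousType.sigmaFinite (hμ : IsSpaceOfHomogeneousType μ) :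
    SigmaFinite μ := by
  rcases isEmpty_or_nonempty X with h | ⟨⟨x⟩⟩
  · rw [Measure.eq_zero_of_isEmpty μ]
    infer_instance
  · exact ⟨⟨⟨fun n : ℕ => Metric.closedBall x n, fun _ => trivial,
      fun n => hμ.measure_closedBall_lt_top x n, Metric.iUnion_closedBall_nat x⟩⟩⟩

/-- A Vitali family of disjoint balls of radius `ε / 5` is countable, since the balls have positive
measure and `μ` is σ-finite; the fivefold enlargements cover, so the centers are `ε`-dense. -/
theorem IsSpaceOfHomogeneousType.secondCountableTopology [BorelSpace X]
    (hμ : IsSpaceOfHomogeneousType μ) : SecondCountableTopology X := by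
  have := hμ.sigmaFinite
  refine Metric.secondCountable_of_almost_dense_set fun ε hε => ?_
  obtain ⟨u, -, hu, hcov⟩ := Vitali.exists_disjoint_subfamily_covering_enlargement_closedBall
    (Set.univ : Set X) id (fun _ => ε / 5) (ε / 5) (fun _ _ => le_rfl) 5 (by norm_num)
  refine ⟨u, ?_, fun x => ?_⟩
  · have h := Measure.countable_meas_pos_of_disjoint_iUnion (μ := μ) (ι := u)
      (As := fun i => Metric.closedBall (i : X) (ε / 5))
      (fun i => Metric.isClosed_closedBall.measurableSet)
      (fun i j hij => hu i.2 j.2 (fun h => hij (Subtype.ext h)))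
    have h2 : {i : u | 0 < μ (Metric.closedBall (i : X) (ε / 5))} = Set.univ :=
      Set.eq_univ_of_forall fun i => hμ.measure_closedBall_pos _ (by positivity)
    rw [h2] at h
    exact Set.countable_coe_iff.1 (Set.countable_univ_iff.1 h)
  · obtain ⟨y, hy, hxy⟩ := hcov x trivial
    refine ⟨y, hy, ?_⟩
    have := hxy (Metric.mem_closedBall_self (by positivity))
    simpa [mul_div_cancel₀] using this

/-- Stopping-time balls for a nonnegative function `w` supported in a ball, at a height `T` that
is at least its mean over that ball. -/
theorem IsSpaceOfHomogeneousType.exists_stopping_balls [BorelSpace X]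
    (hμ : IsSpaceOfHomogeneousType μ) {w : X → ℝ≥0∞} (hw : AEMeasurable w μ) {x₀ : X} {r : ℝ}
    (hr : 0 < r) {T : ℝ≥0∞} (hT : T ≠ ∞)
    (hsupp : Function.support w ⊆ Metric.ball x₀ r)
    (hint : ∫⁻ x, w x ∂μ ≤ T * μ (Metric.ball x₀ r)) :
    ∃ (u : Set X) (ρ : X → ℝ), u.Countable ∧
      (∀ x ∈ u, x ∈ Metric.ball x₀ r ∧ 0 < ρ x ∧ ρ x ≤ 2 * r ∧
        T * μ (Metric.closedBall x (ρ x)) ≤ ∫⁻ y in Metric.closedBall x (ρ x), w y ∂μ ∧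
        ∫⁻ y in Metric.closedBall x (8 * ρ x), w y ∂μ ≤ T * μ (Metric.closedBall x (8 * ρ x))) ∧
      u.PairwiseDisjoint (fun x => Metric.closedBall x (ρ x)) ∧
      ∀ᵐ x ∂μ, x ∉ ⋃ y ∈ u, Metric.closedBall y (8 * ρ y) → w x ≤ T := by
  have := hμ.secondCountableTopology
  have := hμ.isUnifLocDoublingMeasure
  have := hμ.isLocallyFiniteMeasure
  have hfin : ∫⁻ x, w x ∂μ ≠ ∞ :=
    (hint.trans_lt (ENNReal.mul_lt_top hT.lt_top (hμ.measure_ball_lt_top x₀ r hr))).ne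
  -- Radii at which the mean of `w` exceeds `T`. A ball centered in the given one with radius at
  -- least `2 * r` contains it, so such radii are not bad.
  let bad : X → Set ℝ := fun x =>
    {s | 0 < s ∧ T * μ (Metric.closedBall x s) < ∫⁻ y in Metric.closedBall x s, w y ∂μ}
  let t : Set X := {x | x ∈ Metric.ball x₀ r ∧ (bad x).Nonempty}
  have hgood : ∀ x ∈ Metric.ball x₀ r, ∀ s, 2 * r ≤ s → s ∉ bad x := by
    rintro x hx s hs ⟨-, h⟩
    refine h.not_ge ?_
    refine (setLIntegral_le_lintegral _ _).trans (hint.trans ?_)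
    gcongr
    intro y hy
    rw [Metric.mem_ball] at hx hy
    rw [Metric.mem_closedBall]
    linarith [dist_triangle_right y x x₀]
  have hbdd : ∀ x ∈ Metric.ball x₀ r, BddAbove (bad x) := fun x hx =>
    ⟨2 * r, fun s hs => le_of_not_ge fun h => hgood x hx s h hs⟩
  -- A supremum of bad radii need not be attained, so a bad radius above half the supremum is taken.
  have hex : ∀ x ∈ t, ∃ s ∈ bad x, ∀ s', 2 * s ≤ s' → s' ∉ bad x := by
    rintro x ⟨hx, hne⟩
    have hpos : 0 < sSup (bad x) := by
      obtain ⟨s, hs⟩ := hne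
      exact hs.1.trans_le (le_csSup (hbdd x hx) hs)
    obtain ⟨s, hs, hlt⟩ := exists_lt_of_lt_csSup hne (half_lt_self hpos)
    refine ⟨s, hs, fun s' h hs' => ?_⟩
    linarith [le_csSup (hbdd x hx) hs']
  choose! ρ hρ hρ2 using hex
  have hρr : ∀ x ∈ t, ρ x ≤ 2 * r := fun x hx =>
    le_of_not_ge fun h => hgood x hx.1 _ h (hρ x hx)
  obtain ⟨u, hut, hdisj, hcov⟩ := Vitali.exists_disjoint_subfamily_covering_enlargement_closedBall
    t id ρ (2 * r) hρr 5 (by norm_num)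
  refine ⟨u, ρ, ?_, fun x hx => ?_, hdisj, ?_⟩
  · refine Set.PairwiseDisjoint.countable_of_isOpen (s := fun x => Metric.ball x (ρ x))
      (fun x hx y hy hxy => (hdisj hx hy hxy).mono Metric.ball_subset_closedBall
        Metric.ball_subset_closedBall) (fun _ _ => Metric.isOpen_ball)
      (fun x hx => Metric.nonempty_ball.2 (hρ x (hut hx)).1)
  · have h := hρ x (hut hx)
    refine ⟨(hut hx).1, h.1, hρr x (hut hx), h.2.le, ?_⟩
    have h1 := h.1
    -- The factor 8 is at least 2, so the dilated ball is not bad, and at least 5, so the dilates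
    -- contain the Vitali enlargements.
    have h8 := hρ2 x (hut hx) (8 * ρ x) (by linarith)
    by_contra hcon
    exact h8 ⟨by linarith, not_le.1 hcon⟩
  -- Lebesgue differentiation: where `w x > T`, some small ball around `x` is bad, so `x` is covered
  -- by the selected dilates.
  · filter_upwards [(IsUnifLocDoublingMeasure.vitaliFamily μ 1).ae_tendsto_lintegral_div hw hfin]
      with x hx hxu
    by_contra! hlt
    refine hxu ?_
    have hx0 : x ∈ Metric.ball x₀ r := hsupp (ne_of_gt (bot_le.trans_lt hlt))
    have hlim := hx.comp (IsUnifLocDoublingMeasure.tendsto_closedBall_filterAt μ (K := 1)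
      (fun _ : ℝ => x) (fun s : ℝ => s) tendsto_id (by
        filter_upwards [self_mem_nhdsWithin] with s hs
        have hs : 0 < s := hs
        exact Metric.mem_closedBall_self (by linarith)))
    obtain ⟨s, hs, hs0⟩ := ((hlim.eventually (lt_mem_nhds hlt)).and self_mem_nhdsWithin).exists
    have hs0 : 0 < s := hs0
    have hxt : x ∈ t := by
      refine ⟨hx0, s, hs0, ?_⟩
      exact (ENNReal.lt_div_iff_mul_lt (.inl (hμ.measure_closedBall_pos x hs0).ne')
        (.inl (hμ.measure_closedBall_lt_top x s).ne)).1 hs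
    obtain ⟨y, hy, hxy⟩ := hcov x hxt
    have h1 := (hρ x hxt).1
    have h2 := (hρ y (hut hy)).1
    refine Set.mem_biUnion hy ?_
    exact Metric.closedBall_subset_closedBall (by linarith)
      (hxy (Metric.mem_closedBall_self h1.le))

end Geometry

/-! ### Hölder's inequality and disjoint families of sets. -/

section Preliminaries

variable {X : Type*} [MeasurableSpace X] {μ : Measure X}

/-- Hölder's inequality on a set. -/
theorem eLpNorm_one_restrict_le {q : ℝ≥0∞} (hq : 1 ≤ q) {f : X → ℂ}
    (hf : AEStronglyMeasurable f μ) (s : Set X) :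
    eLpNorm f 1 (μ.restrict s) ≤ eLpNorm f q (μ.restrict s) * μ s ^ (1 - (q⁻¹).toReal) := by
  have h := eLpNorm_le_eLpNorm_mul_rpow_measure_univ hq hf.restrict (μ := μ.restrict s)
  simpa [ENNReal.toReal_inv] using h

theorem eLpNorm_one_le_of_support_subset {q : ℝ≥0∞} (hq : 1 ≤ q) {f : X → ℂ}
    (hf : AEStronglyMeasurable f μ) {s : Set X} (hs : Function.support f ⊆ s) :
    eLpNorm f 1 μ ≤ eLpNorm f q μ * μ s ^ (1 - (q⁻¹).toReal) := by
  simpa only [eLpNorm_restrict_eq_of_support_subset hs] using eLpNorm_one_restrict_le hq hf s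

theorem toReal_inv_le_one {q : ℝ≥0∞} (hq : 1 ≤ q) : (q⁻¹).toReal ≤ 1 := by
  have h : q⁻¹ ≤ 1 := ENNReal.inv_le_one.2 hq
  simpa using ENNReal.toReal_mono ENNReal.one_ne_top h

/-- For pairwise disjoint sets the series of indicators has at most one nonzero term. -/
theorem hasSum_indicator_of_mem {ι Y : Type*} {s : ι → Set Y}
    (hs : Pairwise fun i j => Disjoint (s i) (s j)) (f : ι → Y → ℂ) {y : Y} {i : ι}
    (hi : y ∈ s i) : HasSum (fun j => (s j).indicator (f j) y) (f i y) := by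
  have h := hasSum_single (f := fun j => (s j).indicator (f j) y) i fun j hj =>
    Set.indicator_of_notMem (fun hy => Set.disjoint_left.1 (hs hj) hy hi) _
  rwa [Set.indicator_of_mem hi] at h

theorem hasSum_indicator_of_notMem {ι Y : Type*} {s : ι → Set Y} (f : ι → Y → ℂ) {y : Y}
    (hy : ∀ i, y ∉ s i) : HasSum (fun j => (s j).indicator (f j) y) 0 := by
  simp [hy]

/-- A countable family of measurable sets can be shrunk to a disjoint one with the same union. -/
theorem exists_disjoint_refinement {ι : Type*} [Countable ι] {s : ι → Set X}
    (hs : ∀ i, MeasurableSet (s i)) : ∃ t : ι → Set X, (∀ i, MeasurableSet (t i)) ∧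
      (∀ i, t i ⊆ s i) ∧ (Pairwise fun i j => Disjoint (t i) (t j)) ∧
      ∀ x, (∃ i, x ∈ s i) → ∃ i, x ∈ t i := by
  obtain ⟨e, he⟩ := exists_injective_nat ι
  refine ⟨fun i => s i \ ⋃ (j) (_ : e j < e i), s j, fun i => (hs i).diff
    (MeasurableSet.iUnion fun j => MeasurableSet.iUnion fun _ => hs j),
    fun i => Set.sdiff_subset, fun i j hij => ?_, fun x hx => ?_⟩
  · refine Set.disjoint_left.2 ?_
    rintro x ⟨hxi, hxi'⟩ ⟨hxj, hxj'⟩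
    simp only [Set.mem_iUnion, not_exists] at hxi' hxj'
    rcases lt_or_gt_of_ne (he.ne hij) with h | h
    · exact hxj' i h hxi
    · exact hxi' j h hxj
  · obtain ⟨i, hi, hmin⟩ := (measure e).wf.has_min {i | x ∈ s i} hx
    refine ⟨i, hi, ?_⟩
    simp only [Set.mem_iUnion, not_exists]
    exact fun j hj hxj => hmin j hxj hj

end Preliminaries

/-! ### The Calderón–Zygmund decomposition. -/

section CalderonZygmund

variable {X : Type*} [MetricSpace X] [MeasurableSpace X] [BorelSpace X] {μ : Measure X}

theorem MetricBall.measurableSet_toSet (B : MetricBall X) : MeasurableSet B.toSet :=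
  Metric.isOpen_ball.measurableSet

/-- The ball with the same center and the radius multiplied by `32`. -/
def MetricBall.enlarge {X : Type*} (B : MetricBall X) : MetricBall X :=
  ⟨B.center, 32 * B.radius, mul_pos (by norm_num) B.radius_pos⟩

theorem MetricBall.toSet_subset_enlarge {X : Type*} [MetricSpace X] (B : MetricBall X) :
    B.toSet ⊆ B.enlarge.toSet :=
  Metric.ball_subset_ball (by have := B.radius_pos; simp only [enlarge]; linarith)

/-- Calderón–Zygmund decomposition of a function supported in a ball, at `N` times its `L^q`
mean. -/
theorem IsSpaceOfHomogeneousType.exists_calderonZygmund (hμ : IsSpaceOfHomogeneousType μ) :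
    ∃ K : ℝ≥0, 1 ≤ K ∧ (∀ B : MetricBall X, μ B.enlarge.toSet ≤ K * μ B.toSet) ∧
      ∀ (q : ℝ≥0∞), 1 ≤ q → q ≠ ∞ → ∀ (M N : ℝ≥0), M ≠ 0 → 1 ≤ N →
      ∀ (B₀ : MetricBall X) (a : X → ℂ), AEStronglyMeasurable a μ →
        Function.support a ⊆ B₀.toSet →
        eLpNorm a q μ ≤ M * μ B₀.toSet ^ (q⁻¹).toReal →
      ∃ (u : Set X) (B : u → MetricBall X) (h : u → X → ℂ) (g : X → ℂ), u.Countable ∧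
        (∀ i, AEStronglyMeasurable (h i) μ ∧ Function.support (h i) ⊆ (B i).toSet ∧
          Function.support (h i) ⊆ B₀.enlarge.toSet ∧ ∫ x, h i x ∂μ = 0 ∧
          eLpNorm (h i) q μ ≤ (K * N * M : ℝ≥0) * μ (B i).toSet ^ (q⁻¹).toReal) ∧
        (N : ℝ≥0∞) ^ q.toReal * ∑' i, μ (B i).toSet ≤ K * μ B₀.toSet ∧
        AEStronglyMeasurable g μ ∧ Function.support g ⊆ B₀.enlarge.toSet ∧
        eLpNorm g ∞ μ ≤ (K * N * M : ℝ≥0) ∧ ∀ x, HasSum (fun i => h i x) (a x - g x) := by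
  obtain ⟨A, hA1, hA⟩ := hμ.doubling
  have hA1' : (1 : ℝ≥0∞) ≤ A := by exact_mod_cast hA1
  -- `A ^ 5` is the doubling cost of `32 = 2 ^ 5`; the summand 1 pays for `a` itself in the bounds
  -- for `g` and the `h i`.
  refine ⟨1 + A ^ 5, le_self_add, fun B => ?_, ?_⟩
  · have h := measure_ball_two_pow_mul_le hA B.center B.radius_pos 5
    norm_num at h
    refine h.trans ?_
    push_cast
    exact mul_le_mul_left le_add_self _
  intro q hq1 hqt M N hM0 hN1 B₀ a ham hasupp hanorm
  have hq0 : q ≠ 0 := (zero_lt_one.trans_le hq1).ne'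
  have hqr : 0 < q.toReal := ENNReal.toReal_pos hq0 hqt
  have hqi : (q⁻¹).toReal = 1 / q.toReal := by rw [ENNReal.toReal_inv, one_div]
  set θ : ℝ≥0 := N * M with hθ
  have hNN : (1 : ℝ≥0∞) ≤ N := by exact_mod_cast hN1
  have hlint : ∫⁻ x, ‖a x‖ₑ ^ q.toReal ∂μ ≤ (M : ℝ≥0∞) ^ q.toReal * μ B₀.toSet := by
    rw [eLpNorm_eq_lintegral_rpow_enorm_toReal hq0 hqt, hqi] at hanorm
    have := ENNReal.rpow_le_rpow hanorm hqr.le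
    rwa [ENNReal.mul_rpow_of_nonneg _ _ hqr.le, ← ENNReal.rpow_mul, ← ENNReal.rpow_mul,
      one_div_mul_cancel hqr.ne', ENNReal.rpow_one, ENNReal.rpow_one] at this
  -- Stopping for `|a|^q` at height `(N M)^q`, which is at least its mean because that is at most
  -- `M^q` and `N ≥ 1`.
  obtain ⟨u, ρ, hu, huprop, hudisj, hae⟩ := hμ.exists_stopping_balls
    (w := fun x => ‖a x‖ₑ ^ q.toReal) (ham.enorm.pow_const _) B₀.radius_pos
    (T := (θ : ℝ≥0∞) ^ q.toReal) (ENNReal.rpow_ne_top_of_nonneg hqr.le ENNReal.coe_ne_top)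
    (x₀ := B₀.center) (fun x hx => hasupp (by
      intro h0
      apply hx
      simp [h0, hqr]))
    (hlint.trans (by
      rw [hθ]
      push_cast
      gcongr
      · exact le_mul_of_one_le_left bot_le hNN
      · exact le_rfl))
  have : Countable u := hu.to_subtype
  let P : u → Set X := fun i => Metric.closedBall i (8 * ρ i)
  let Q : u → Set X := fun i => Metric.closedBall i (ρ i)
  have hPm : ∀ i, MeasurableSet (P i) := fun i => Metric.isClosed_closedBall.measurableSet
  have hQm : ∀ i, MeasurableSet (Q i) := fun i => Metric.isClosed_closedBall.measurableSet
  have hQdisj : Pairwise fun i j => Disjoint (Q i) (Q j) := fun i j hij =>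
    hudisj i.2 j.2 fun h => hij (Subtype.ext h)
  -- The dilates `P i` overlap, so `a` is cut along disjoint pieces `E i ⊆ P i` with the same union.
  obtain ⟨E, hEm, hEP, hEdisj, hEcov⟩ := exists_disjoint_refinement hPm
  have hρ : ∀ i : u, 0 < ρ i := fun i => (huprop i i.2).2.1
  let B : u → MetricBall X := fun i => ⟨i, 16 * ρ i, by have := hρ i; positivity⟩
  have hQP : ∀ i, Q i ⊆ P i := fun i =>
    Metric.closedBall_subset_closedBall (by linarith [hρ i])
  have hPB : ∀ i, P i ⊆ (B i).toSet := fun i =>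
    Metric.closedBall_subset_ball (by linarith [hρ i])
  -- The center lies in `B₀` and `8 * ρ i ≤ 16 * B₀.radius`, so 17 times the radius would be enough.
  have hPB₀ : ∀ i, P i ⊆ B₀.enlarge.toSet := by
    intro i x hx
    have h1 := (huprop i i.2).1
    have h2 := (huprop i i.2).2.2.1
    have hx : dist x i ≤ 8 * ρ i := hx
    have h1 : dist (i : X) B₀.center < B₀.radius := h1
    change dist x B₀.center < 32 * B₀.radius
    linarith [dist_triangle x i B₀.center, B₀.radius_pos]
  have hBQ : ∀ i, μ (B i).toSet ≤ (A : ℝ≥0∞) ^ 4 * μ (Q i) := by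
    intro i
    have h := measure_ball_two_pow_mul_le hA (i : X) (hρ i) 4
    norm_num at h
    refine h.trans ?_
    gcongr
    exact Metric.ball_subset_closedBall
  have hQ0 : ∀ i, μ (Q i) ≠ 0 := fun i => (hμ.measure_closedBall_pos _ (hρ i)).ne'
  have hQt : ∀ i, μ (Q i) ≠ ∞ := fun i => (hμ.measure_closedBall_lt_top _ _).ne
  have hPt : ∀ i, μ (P i) ≠ ∞ := fun i => (hμ.measure_closedBall_lt_top _ _).ne
  have hP0 : ∀ i, μ (P i) ≠ 0 := fun i =>
    (hμ.measure_closedBall_pos _ (by linarith [hρ i])).ne'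
  have haP : ∀ i, eLpNorm a q (μ.restrict (P i)) ≤ θ * μ (P i) ^ (q⁻¹).toReal := by
    intro i
    have h := (huprop i i.2).2.2.2.2
    have := ENNReal.rpow_le_rpow h (z := 1 / q.toReal) (by positivity)
    rwa [ENNReal.mul_rpow_of_nonneg _ _ (by positivity), ← ENNReal.rpow_mul,
      mul_one_div_cancel hqr.ne', ENNReal.rpow_one, ← hqi, hqi,
      ← eLpNorm_eq_lintegral_rpow_enorm_toReal hq0 hqt, ← hqi] at this
  have haP1 : ∀ i, ∫⁻ x in P i, ‖a x‖ₑ ∂μ ≤ θ * μ (P i) := by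
    intro i
    rw [← eLpNorm_one_eq_lintegral_enorm]
    calc eLpNorm a 1 (μ.restrict (P i))
        ≤ eLpNorm a q (μ.restrict (P i)) * μ (P i) ^ (1 - (q⁻¹).toReal) :=
          eLpNorm_one_restrict_le hq1 ham _
      _ ≤ θ * μ (P i) ^ (q⁻¹).toReal * μ (P i) ^ (1 - (q⁻¹).toReal) := by
          gcongr
          exact haP i
      _ = θ * μ (P i) := by
          rw [mul_assoc, ← ENNReal.rpow_add _ _ (hP0 i) (hPt i)]
          simp
  have haint : Integrable a μ := by
    refine memLp_one_iff_integrable.1 ⟨ham, ?_⟩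
    refine (eLpNorm_one_le_of_support_subset hq1 ham hasupp).trans_lt ?_
    have hB₀ := (hμ.measure_ball_lt_top B₀.center B₀.radius B₀.radius_pos).ne
    refine ENNReal.mul_lt_top (hanorm.trans_lt (ENNReal.mul_lt_top ENNReal.coe_lt_top ?_)) ?_
    · exact ENNReal.rpow_lt_top_of_nonneg ENNReal.toReal_nonneg hB₀
    · exact ENNReal.rpow_lt_top_of_nonneg (sub_nonneg.2 (toReal_inv_le_one hq1)) hB₀
  -- The constant that, placed on `Q i`, cancels the integral of `a` over `E i`. It is put on `Q i`
  -- rather than `E i` because the `Q i` are disjoint with measure comparable to that of `P i`,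
  -- whereas `E i` may be small; hence `c i` and the sum `v` stay bounded.
  let c : u → ℂ := fun i => ((μ.real (Q i))⁻¹ : ℝ) • ∫ x in E i, a x ∂μ
  have hc : ∀ i, ‖c i‖ₑ ≤ (A : ℝ≥0∞) ^ 4 * θ := by
    intro i
    have h1 : ‖c i‖ₑ ≤ (μ (Q i))⁻¹ * (θ * μ (P i)) := by
      simp only [c]
      rw [Measure.real, enorm_smul, Real.enorm_of_nonneg (by positivity), ENNReal.ofReal_inv_of_pos
        (ENNReal.toReal_pos (hQ0 i) (hQt i)), ENNReal.ofReal_toReal (hQt i)]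
      gcongr
      exact (enorm_integral_le_lintegral_enorm _).trans
        ((lintegral_mono_set (hEP i)).trans (haP1 i))
    refine h1.trans ?_
    calc (μ (Q i))⁻¹ * (θ * μ (P i)) ≤ (μ (Q i))⁻¹ * (θ * ((A : ℝ≥0∞) ^ 4 * μ (Q i))) := by
          gcongr
          exact (measure_mono (hPB i)).trans (hBQ i)
      _ = ((μ (Q i))⁻¹ * μ (Q i)) * ((A : ℝ≥0∞) ^ 4 * θ) := by ring
      _ = (A : ℝ≥0∞) ^ 4 * θ := by rw [ENNReal.inv_mul_cancel (hQ0 i) (hQt i), one_mul]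
  let h : u → X → ℂ := fun i => (E i).indicator a - (Q i).indicator fun _ => c i
  let v : X → ℂ := fun x => ∑' i, (Q i).indicator (fun _ => c i) x
  have hvsum : ∀ x, HasSum (fun i => (Q i).indicator (fun _ => c i) x) (v x) ∧
      ‖v x‖ₑ ≤ (A : ℝ≥0∞) ^ 4 * θ := by
    intro x
    by_cases hx : ∃ i, x ∈ Q i
    · obtain ⟨i, hi⟩ := hx
      have := hasSum_indicator_of_mem hQdisj (fun i _ => c i) hi
      refine ⟨this.summable.hasSum, ?_⟩
      rw [show v x = c i from this.tsum_eq]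
      exact hc i
    · have := hasSum_indicator_of_notMem (fun i _ => c i) (not_exists.1 hx)
      refine ⟨this.summable.hasSum, ?_⟩
      rw [show v x = 0 from this.tsum_eq]
      simp
  have hvm : AEStronglyMeasurable v μ :=
    aestronglyMeasurable_of_tendsto_ae (atTop : Filter (Finset u))
      (f := fun s x => ∑ i ∈ s, (Q i).indicator (fun _ => c i) x)
      (fun s => Finset.aestronglyMeasurable_fun_sum s fun i _ =>
        aestronglyMeasurable_const.indicator (hQm i))
      (Eventually.of_forall fun x => (hvsum x).1)
  let U : Set X := ⋃ i, P i
  have hUm : MeasurableSet U := MeasurableSet.iUnion hPm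
  let g : X → ℂ := fun x => Uᶜ.indicator a x + v x
  have hhE : ∀ i x, x ∉ P i → h i x = 0 := by
    intro i x hx
    simp only [h, Pi.sub_apply]
    rw [Set.indicator_of_notMem fun h => hx (hEP i h), Set.indicator_of_notMem fun h => hx (hQP i h),
      sub_zero]
  have hhsum : ∀ x, HasSum (fun i => h i x) (a x - g x) := by
    intro x
    have h1 : HasSum (fun i => (E i).indicator a x) (U.indicator a x) := by
      by_cases hx : ∃ i, x ∈ P i
      · obtain ⟨i, hi⟩ := hEcov x hx
        rw [Set.indicator_of_mem (Set.mem_iUnion.2 hx)]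
        exact hasSum_indicator_of_mem hEdisj (fun _ => a) hi
      · rw [Set.indicator_of_notMem fun h => hx (Set.mem_iUnion.1 h)]
        exact hasSum_indicator_of_notMem (fun _ => a) fun i hi => hx ⟨i, hEP i hi⟩
    have h2 := h1.sub (hvsum x).1
    have h3 : U.indicator a x - v x = a x - g x := by
      have := congrFun (Set.indicator_self_add_compl U a) x
      simp only [Pi.add_apply] at this
      simp only [g, ← this]
      ring
    rwa [h3] at h2
  refine ⟨u, B, h, g, hu, fun i => ⟨?_, ?_, ?_, ?_, ?_⟩, ?_, ?_, ?_, ?_, hhsum⟩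
  · exact (ham.indicator (hEm i)).sub (aestronglyMeasurable_const.indicator (hQm i))
  · exact fun x hx => hPB i (by_contra fun hxP => hx (hhE i x hxP))
  · exact fun x hx => hPB₀ i (by_contra fun hxP => hx (hhE i x hxP))
  · have hi2 : Integrable ((Q i).indicator fun _ => c i) μ :=
      (integrable_indicator_iff (hQm i)).2 (integrableOn_const (hQt i))
    have := integral_sub (haint.indicator (hEm i)) hi2
    refine this.trans ?_
    rw [integral_indicator (hEm i), integral_indicator (hQm i), setIntegral_const, sub_eq_zero]
    simp only [c]
    rw [Measure.real, smul_smul, mul_inv_cancel₀ (ENNReal.toReal_pos (hQ0 i) (hQt i)).ne', one_smul]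
  · calc eLpNorm (h i) q μ
        ≤ eLpNorm ((E i).indicator a) q μ + eLpNorm ((Q i).indicator fun _ => c i) q μ :=
          eLpNorm_sub_le (ham.indicator (hEm i))
            (aestronglyMeasurable_const.indicator (hQm i)) hq1
      _ ≤ θ * μ (P i) ^ (q⁻¹).toReal + (A : ℝ≥0∞) ^ 4 * θ * μ (Q i) ^ (q⁻¹).toReal := by
          gcongr
          · rw [eLpNorm_indicator_eq_eLpNorm_restrict (hEm i)]
            exact (eLpNorm_mono_measure _ (Measure.restrict_mono (hEP i) le_rfl)).trans (haP i)
          · rw [eLpNorm_indicator_const (hQm i) hq0 hqt, hqi]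
            gcongr
            exact hc i
      _ ≤ θ * μ (B i).toSet ^ (q⁻¹).toReal +
            (A : ℝ≥0∞) ^ 5 * θ * μ (B i).toSet ^ (q⁻¹).toReal := by
          gcongr
          · exact hPB i
          · norm_num
          · exact (hQP i).trans (hPB i)
      _ = ((1 + A ^ 5) * N * M : ℝ≥0) * μ (B i).toSet ^ (q⁻¹).toReal := by
          rw [hθ]
          push_cast
          ring
  · have hMq0 : (M : ℝ≥0∞) ^ q.toReal ≠ 0 := by
      simp [ENNReal.rpow_eq_zero_iff, hM0]
    have hMqt : (M : ℝ≥0∞) ^ q.toReal ≠ ∞ :=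
      ENNReal.rpow_ne_top_of_nonneg hqr.le ENNReal.coe_ne_top
    have h1 : (θ : ℝ≥0∞) ^ q.toReal * ∑' i, μ (Q i) ≤ (M : ℝ≥0∞) ^ q.toReal * μ B₀.toSet := by
      rw [← ENNReal.tsum_mul_left]
      calc ∑' i, (θ : ℝ≥0∞) ^ q.toReal * μ (Q i)
          ≤ ∑' i, ∫⁻ x in Q i, ‖a x‖ₑ ^ q.toReal ∂μ :=
            ENNReal.tsum_le_tsum fun i => (huprop i i.2).2.2.2.1
        _ = ∫⁻ x in ⋃ i, Q i, ‖a x‖ₑ ^ q.toReal ∂μ := (lintegral_iUnion hQm hQdisj _).symm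
        _ ≤ ∫⁻ x, ‖a x‖ₑ ^ q.toReal ∂μ := setLIntegral_le_lintegral _ _
        _ ≤ _ := hlint
    -- The common factor `M ^ q` cancels, leaving a bound independent of the size of `a`.
    have h2 : (N : ℝ≥0∞) ^ q.toReal * ∑' i, μ (Q i) ≤ μ B₀.toSet := by
      refine (ENNReal.mul_le_mul_iff_right hMq0 hMqt).1 (le_trans (le_of_eq ?_) h1)
      rw [hθ]
      push_cast
      rw [ENNReal.mul_rpow_of_nonneg _ _ hqr.le]
      ring
    calc (N : ℝ≥0∞) ^ q.toReal * ∑' i, μ (B i).toSet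
        ≤ (N : ℝ≥0∞) ^ q.toReal * ∑' i, (A : ℝ≥0∞) ^ 4 * μ (Q i) := by
          gcongr with i
          exact hBQ i
      _ = (A : ℝ≥0∞) ^ 4 * ((N : ℝ≥0∞) ^ q.toReal * ∑' i, μ (Q i)) := by
          rw [ENNReal.tsum_mul_left]
          ring
      _ ≤ (A : ℝ≥0∞) ^ 5 * μ B₀.toSet := by
          gcongr
          norm_num
      _ ≤ _ := by
          push_cast
          gcongr
          exact le_add_self
  · exact (ham.indicator hUm.compl).add hvm
  · intro x hx
    by_contra hxB
    refine hx ?_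
    have hxP : ∀ i, x ∉ P i := fun i hi => hxB (hPB₀ i hi)
    have h1 : a x - g x = 0 :=
      (hhsum x).unique (by simp [fun i => hhE i x (hxP i)])
    have h2 : a x = 0 := by
      by_contra h0
      exact hxB (B₀.toSet_subset_enlarge (hasupp h0))
    simpa [h2] using h1
  · refine eLpNormEssSup_le_of_ae_enorm_bound ?_
    filter_upwards [hae] with x hx
    have h1 : ‖Uᶜ.indicator a x‖ₑ ≤ θ := by
      by_cases hxU : x ∈ U
      · rw [Set.indicator_of_notMem (by simpa using hxU)]
        simp
      · rw [Set.indicator_of_mem hxU]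
        refine (ENNReal.rpow_le_rpow_iff hqr).1 (hx ?_)
        simpa [U, P] using hxU
    calc ‖g x‖ₑ ≤ ‖Uᶜ.indicator a x‖ₑ + ‖v x‖ₑ := enorm_add_le _ _
      _ ≤ θ + (A : ℝ≥0∞) ^ 5 * θ := by
          refine add_le_add h1 ((hvsum x).2.trans ?_)
          gcongr
          norm_num
      _ = ((1 + A ^ 5) * N * M : ℝ≥0) := by
          rw [hθ]
          push_cast
          ring

end CalderonZygmund

/-! ### Normalization of functions on balls. -/

section Sized

variable {X : Type*} [MetricSpace X] [MeasurableSpace X] {μ : Measure X}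

theorem IsSpaceOfHomogeneousType.measure_toSet_ne_zero (hμ : IsSpaceOfHomogeneousType μ)
    (B : MetricBall X) : μ B.toSet ≠ 0 :=
  (hμ.measure_ball_pos _ _ B.radius_pos).ne'

theorem IsSpaceOfHomogeneousType.measure_toSet_ne_top (hμ : IsSpaceOfHomogeneousType μ)
    (B : MetricBall X) : μ B.toSet ≠ ∞ :=
  (hμ.measure_ball_lt_top _ _ B.radius_pos).ne

theorem IsSpaceOfHomogeneousType.measureReal_toSet_pos (hμ : IsSpaceOfHomogeneousType μ)
    (B : MetricBall X) : 0 < μ.real B.toSet :=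
  ENNReal.toReal_pos (hμ.measure_toSet_ne_zero B) (hμ.measure_toSet_ne_top B)

/-- The power of the measure from Hölder's inequality removes the dependence on `q`. It is used with
`s = 1 / p` for atoms and with `s = 0` for Calderón–Zygmund pieces. -/
theorem IsSpaceOfHomogeneousType.eLpNorm_one_le (hμ : IsSpaceOfHomogeneousType μ) {q : ℝ≥0∞}
    (hq : 1 ≤ q) {f : X → ℂ} (hf : AEStronglyMeasurable f μ) {B : MetricBall X}
    (hs : Function.support f ⊆ B.toSet) {c : ℝ≥0∞} {s : ℝ}
    (hc : eLpNorm f q μ ≤ c * μ B.toSet ^ ((q⁻¹).toReal - s)) :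
    eLpNorm f 1 μ ≤ c * μ B.toSet ^ (1 - s) := by
  calc eLpNorm f 1 μ ≤ eLpNorm f q μ * μ B.toSet ^ (1 - (q⁻¹).toReal) :=
        eLpNorm_one_le_of_support_subset hq hf hs
    _ ≤ c * μ B.toSet ^ ((q⁻¹).toReal - s) * μ B.toSet ^ (1 - (q⁻¹).toReal) := by gcongr
    _ = c * μ B.toSet ^ (1 - s) := by
      rw [mul_assoc, ← ENNReal.rpow_add _ _ (hμ.measure_toSet_ne_zero B)
        (hμ.measure_toSet_ne_top B)]
      congr 2
      ring

theorem IsSpaceOfHomogeneousType.integrable_of_eLpNorm_le (hμ : IsSpaceOfHomogeneousType μ)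
    {q : ℝ≥0∞} (hq : 1 ≤ q) {f : X → ℂ} (hf : AEStronglyMeasurable f μ) {B : MetricBall X}
    (hs : Function.support f ⊆ B.toSet) {c : ℝ≥0} {s : ℝ}
    (hc : eLpNorm f q μ ≤ c * μ B.toSet ^ ((q⁻¹).toReal - s)) : Integrable f μ := by
  refine memLp_one_iff_integrable.1 ⟨hf, (hμ.eLpNorm_one_le hq hf hs hc).trans_lt ?_⟩
  refine ENNReal.mul_lt_top ENNReal.coe_lt_top (lt_top_iff_ne_top.2 ?_)
  simp [ENNReal.rpow_eq_top_iff, hμ.measure_toSet_ne_zero B, hμ.measure_toSet_ne_top B]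

variable {p : ℝ}

theorem IsSizedOn.eLpNorm_one_le (hμ : IsSpaceOfHomogeneousType μ) {q : ℝ≥0∞} (hq : 1 ≤ q)
    {a : X → ℂ} {B : MetricBall X} (h : IsSizedOn μ p q a B) :
    eLpNorm a 1 μ ≤ μ B.toSet ^ (1 - 1 / p) := by
  simpa using hμ.eLpNorm_one_le (c := 1) hq h.aestronglyMeasurable h.support_subset
    (by simpa using h.eLpNorm_le)

theorem IsSizedOn.integrable (hμ : IsSpaceOfHomogeneousType μ) {q : ℝ≥0∞} (hq : 1 ≤ q)
    {a : X → ℂ} {B : MetricBall X} (h : IsSizedOn μ p q a B) : Integrable a μ :=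
  hμ.integrable_of_eLpNorm_le (c := 1) hq h.aestronglyMeasurable h.support_subset
    (by simpa using h.eLpNorm_le)

theorem IsSizedOn.of_top (hμ : IsSpaceOfHomogeneousType μ) {a : X → ℂ} {B : MetricBall X}
    (h : IsSizedOn μ p ∞ a B) (q : ℝ≥0∞) : IsSizedOn μ p q a B := by
  refine ⟨h.aestronglyMeasurable, h.support_subset, ?_⟩
  have h1 := eLpNorm_le_eLpNorm_mul_rpow_measure_univ (le_top : q ≤ ∞)
    (h.aestronglyMeasurable.restrict (s := B.toSet))
  rw [eLpNorm_restrict_eq_of_support_subset h.support_subset,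
    eLpNorm_restrict_eq_of_support_subset h.support_subset] at h1
  have h2 : eLpNorm a q μ ≤ eLpNorm a ∞ μ * μ B.toSet ^ (q⁻¹).toReal := by
    simpa [ENNReal.toReal_inv] using h1
  refine h2.trans ((mul_le_mul_left h.eLpNorm_le _).trans_eq ?_)
  rw [← ENNReal.rpow_add _ _ (hμ.measure_toSet_ne_zero B) (hμ.measure_toSet_ne_top B)]
  congr 1
  simp
  ring

/-- The factor that normalizes a function of size `c` on the ball `B`. -/
def atomFactor (μ : Measure X) (p : ℝ) (c : ℝ≥0) (B : MetricBall X) : ℝ :=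
  c * μ.real B.toSet ^ (1 / p)

theorem IsSpaceOfHomogeneousType.atomFactor_pos (hμ : IsSpaceOfHomogeneousType μ) {c : ℝ≥0}
    (hc : c ≠ 0) (B : MetricBall X) : 0 < atomFactor μ p c B :=
  mul_pos (NNReal.coe_pos.2 (pos_iff_ne_zero.2 hc))
    (Real.rpow_pos_of_pos (hμ.measureReal_toSet_pos B) _)

/-- The `p`-th power is linear in the measure of the ball, so sums of coefficients reduce to sums of
measures. -/
theorem atomFactor_rpow (hp0 : 0 < p) (c : ℝ≥0) (B : MetricBall X) :
    atomFactor μ p c B ^ p = (c : ℝ) ^ p * μ.real B.toSet := by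
  rw [atomFactor, Real.mul_rpow c.coe_nonneg (by positivity), ← Real.rpow_mul measureReal_nonneg,
    one_div_mul_cancel hp0.ne', Real.rpow_one]

theorem IsSpaceOfHomogeneousType.isSizedOn_inv_smul (hμ : IsSpaceOfHomogeneousType μ)
    {q : ℝ≥0∞} {h : X → ℂ} (hm : AEStronglyMeasurable h μ) {B : MetricBall X}
    (hs : Function.support h ⊆ B.toSet) {c : ℝ≥0} (hc0 : c ≠ 0)
    (hc : eLpNorm h q μ ≤ c * μ B.toSet ^ (q⁻¹).toReal) :
    IsSizedOn μ p q (((atomFactor μ p c B : ℂ))⁻¹ • h) B := by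
  refine ⟨hm.const_smul _, (Function.support_const_smul_subset _ _).trans hs, ?_⟩
  have hV0 := hμ.measure_toSet_ne_zero B
  have hVt := hμ.measure_toSet_ne_top B
  have hpos := hμ.atomFactor_pos (p := p) hc0 B
  have hfac : ‖((atomFactor μ p c B : ℂ))⁻¹‖ₑ = (c * μ B.toSet ^ (1 / p))⁻¹ := by
    rw [← Complex.ofReal_inv, ← ofReal_norm, Complex.norm_real, Real.norm_of_nonneg
      (inv_nonneg.2 hpos.le), ENNReal.ofReal_inv_of_pos hpos, atomFactor,
      ENNReal.ofReal_mul c.coe_nonneg, ← ENNReal.ofReal_rpow_of_pos (hμ.measureReal_toSet_pos B),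
      ofReal_measureReal hVt]
    simp
  rw [eLpNorm_const_smul, hfac]
  have hc0' : (c : ℝ≥0∞) ≠ 0 := by exact_mod_cast hc0
  have hVp0 : μ B.toSet ^ (1 / p) ≠ 0 := by simp [ENNReal.rpow_eq_zero_iff, hV0, hVt]
  have hVpt : μ B.toSet ^ (1 / p) ≠ ∞ := by simp [ENNReal.rpow_eq_top_iff, hV0, hVt]
  calc (c * μ B.toSet ^ (1 / p))⁻¹ * eLpNorm h q μ
      ≤ (c * μ B.toSet ^ (1 / p))⁻¹ * (c * μ B.toSet ^ (q⁻¹).toReal) := by gcongr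
    _ = (c * μ B.toSet ^ (1 / p))⁻¹ * (c * μ B.toSet ^ (1 / p)) *
          μ B.toSet ^ ((q⁻¹).toReal - 1 / p) := by
        rw [mul_assoc, mul_assoc, ← ENNReal.rpow_add _ _ hV0 hVt]
        congr 4
        ring
    _ = μ B.toSet ^ ((q⁻¹).toReal - 1 / p) := by
        rw [ENNReal.inv_mul_cancel (mul_ne_zero hc0' hVp0)
          (ENNReal.mul_ne_top ENNReal.coe_ne_top hVpt), one_mul]

end Sized

/-! ### Splitting a `(p, q)`-atom in the ambient space. -/

section Realization

variable {X : Type u} [MetricSpace X] [MeasurableSpace X]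
  {E : Type*} [SeminormedAddCommGroup E] [NormedSpace ℂ E]

/-- The functions allowed in an atomic decomposition. -/
def atomClass (μ : Measure X) (D : Set (MetricBall X)) (p : ℝ) (q : ℝ≥0∞) (a : X → ℂ) : Prop :=
  IsAtom μ p q a ∨ IsLocalAtom μ D p q a ∨ a = 0

/-- The properties of the ways in which atoms are viewed as elements of the ambient space `E`
that the theory of atomic decompositions uses. -/
structure IsRealization (R : (X → ℂ) → E → Prop) (μ : Measure X) (D : Set (MetricBall X))
    (p : ℝ) : Prop where
  zero : R 0 0
  exists_of_atomClass : ∀ q : ℝ≥0∞, 1 ≤ q → ∀ a, atomClass μ D p q a → ∃ S, R a S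
  norm_le : ∀ q : ℝ≥0∞, 1 ≤ q → ∀ a S, atomClass μ D p q a → R a S → ‖S‖ ≤ 1
  smul : ∀ (c : ℂ) a S, R a S → R (c • a) (c • S)
  sub : ∀ (B : MetricBall X) (a b : X → ℂ) (S T : E), Function.support a ⊆ B.toSet →
    Function.support b ⊆ B.toSet → Integrable a μ → Integrable b μ → R a S → R b T →
    R (a - b) (S - T)
  -- Only the value of the sum is at stake, convergence in `E` being assumed. The universe is that
  -- of `X` because the index type will be a set of ball centers; the common ball `B` provides a
  -- uniform bound for the test functions.
  hasSum : ∀ (ι : Type u) [Countable ι] (B : MetricBall X) (h : ι → X → ℂ) (a : X → ℂ)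
    (S : ι → E) (T : E), (∀ i, Function.support (h i) ⊆ B.toSet) → (∀ i, Integrable (h i) μ) →
    ∑' i, eLpNorm (h i) 1 μ ≠ ∞ → (∀ x, HasSum (fun i => h i x) (a x)) →
    (∀ i, R (h i) (S i)) → R a T → Summable S → HasSum S T

variable {R : (X → ℂ) → E → Prop} {μ : Measure X} {D : Set (MetricBall X)} {p : ℝ}

/-- A mean zero function supported in a ball splits into a multiple of a `(p, ∞)`-atom and a
series of multiples of `(p, q)`-atoms with small coefficients. -/
theorem IsRealization.exists_split_of_integral_eq_zero [CompleteSpace E] [BorelSpace X]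
    (hR : IsRealization R μ D p) (hμ : IsSpaceOfHomogeneousType μ) (hp0 : 0 < p) (hp1 : p ≤ 1)
    {q : ℝ≥0∞} (hq1 : 1 ≤ q) (hqt : q ≠ ∞) (hpq : p < q.toReal) :
    ∃ K : ℝ, 0 ≤ K ∧ ∀ (B₀ : MetricBall X) (a : X → ℂ) (S : E), AEStronglyMeasurable a μ →
      Function.support a ⊆ B₀.toSet → ∫ x, a x ∂μ = 0 →
      eLpNorm a q μ ≤ 2 * μ B₀.toSet ^ ((q⁻¹).toReal - 1 / p) → R a S →
      ∃ S₁ S₂, S = S₁ + S₂ ∧ HasDecomp R (atomClass μ D p ∞) p S₁ K ∧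
        HasDecomp R (atomClass μ D p q) p S₂ (1 / 2) := by
  obtain ⟨K, hK1, hKB, hCZ⟩ := hμ.exists_calderonZygmund
  have hK0 : K ≠ 0 := (zero_lt_one.trans_le hK1).ne'
  -- The left side will bound the sum of `p`-th powers of the bad coefficients; it tends to 0 as `N
  -- → ∞` because `p < q`.
  obtain ⟨N, hN1, hN⟩ : ∃ N : ℝ≥0, 1 ≤ N ∧
      (K : ℝ) ^ p * 2 ^ p * K * (N : ℝ) ^ (-(q.toReal - p)) ≤ 1 / 2 := by
    have h := (tendsto_rpow_neg_atTop (sub_pos.2 hpq)).const_mul ((K : ℝ) ^ p * 2 ^ p * K)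
    rw [mul_zero] at h
    obtain ⟨N, hN, hN1⟩ := ((h.eventually_le_const (by norm_num : (0 : ℝ) < 1 / 2)).and
      (eventually_ge_atTop 1)).exists
    exact ⟨⟨N, by linarith⟩, hN1, hN⟩
  have hN0 : N ≠ 0 := (zero_lt_one.trans_le hN1).ne'
  refine ⟨((K : ℝ) * N) ^ p * 2 ^ p * K, by positivity, fun B₀ a S ham hasupp haint hanorm haS => ?_⟩
  have hV0 := hμ.measure_toSet_ne_zero B₀
  have hVt := hμ.measure_toSet_ne_top B₀
  have hVpos := hμ.measureReal_toSet_pos B₀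
  -- The bound for the `L^q` mean of `a`. The product `M ^ p * μ(B₀) = 2 ^ p` makes all estimates
  -- independent of `B₀`.
  let M : ℝ≥0 := 2 * (μ B₀.toSet).toNNReal ^ (-(1 / p))
  have hM0 : M ≠ 0 :=
    mul_ne_zero two_ne_zero (NNReal.rpow_pos (ENNReal.toNNReal_pos hV0 hVt)).ne'
  have hMV : (M : ℝ) ^ p * μ.real B₀.toSet = 2 ^ p := by
    have h1 : (M : ℝ) = 2 * μ.real B₀.toSet ^ (-(1 / p)) := by
      simp only [M]
      push_cast
      rfl
    rw [h1, Real.mul_rpow (by norm_num) (by positivity), ← Real.rpow_mul hVpos.le, neg_mul,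
      one_div_mul_cancel hp0.ne', Real.rpow_neg_one, mul_assoc, inv_mul_cancel₀ hVpos.ne', mul_one]
  have hMcoe : (M : ℝ≥0∞) = 2 * μ B₀.toSet ^ (-(1 / p)) := by
    simp only [M]
    rw [ENNReal.coe_mul, ENNReal.coe_rpow_of_ne_zero (ENNReal.toNNReal_pos hV0 hVt).ne',
      ENNReal.coe_toNNReal hVt]
    rfl
  have hanorm' : eLpNorm a q μ ≤ M * μ B₀.toSet ^ (q⁻¹).toReal := by
    rw [hMcoe, mul_assoc, ← ENNReal.rpow_add _ _ hV0 hVt, neg_add_eq_sub]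
    exact hanorm
  obtain ⟨u, B, h, g, hu, hh, hsum, hgm, hgs, hgn, hpt⟩ :=
    hCZ q hq1 hqt M N hM0 hN1 B₀ a ham hasupp hanorm'
  have : Countable u := hu.to_subtype
  set c : ℝ≥0 := K * N * M with hc
  have hc0 : c ≠ 0 := mul_ne_zero (mul_ne_zero hK0 hN0) hM0
  have haI : Integrable a μ := hμ.integrable_of_eLpNorm_le (c := 2) hq1 ham hasupp
    (by simpa using hanorm)
  have hhI : ∀ i, Integrable (h i) μ := fun i =>
    hμ.integrable_of_eLpNorm_le (c := c) (s := 0) hq1 (hh i).1 (hh i).2.1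
      (by simpa using (hh i).2.2.2.2)
  have hgI : Integrable g μ := hμ.integrable_of_eLpNorm_le (c := c) (s := 0) le_top hgm hgs
    (by simpa using hgn)
  have hBsum : ∑' i, μ (B i).toSet ≠ ∞ := by
    intro htop
    rw [htop, ENNReal.mul_top (by
      simp only [ne_eq, ENNReal.rpow_eq_zero_iff]
      rintro (h | h)
      · exact hN0 (by exact_mod_cast h.1)
      · exact ENNReal.coe_ne_top h.1)] at hsum
    exact (ENNReal.mul_ne_top ENNReal.coe_ne_top hVt) (top_le_iff.1 hsum)
  have hBs : Summable fun i => μ.real (B i).toSet := ENNReal.summable_toReal hBsum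
  have hBle : (N : ℝ) ^ q.toReal * ∑' i, μ.real (B i).toSet ≤ K * μ.real B₀.toSet := by
    have h1 := ENNReal.toReal_mono (ENNReal.mul_ne_top ENNReal.coe_ne_top hVt) hsum
    rw [ENNReal.toReal_mul, ENNReal.toReal_mul, ← ENNReal.toReal_rpow, ENNReal.tsum_toReal_eq
      fun i => hμ.measure_toSet_ne_top _] at h1
    exact h1
  have hL1 : ∑' i, eLpNorm (h i) 1 μ ≠ ∞ := by
    have h1 : ∑' i, eLpNorm (h i) 1 μ ≤ ∑' i, c * μ (B i).toSet := by
      refine ENNReal.tsum_le_tsum fun i => ?_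
      simpa using hμ.eLpNorm_one_le (c := c) (s := 0) hq1 (hh i).1 (hh i).2.1
        (by simpa using (hh i).2.2.2.2)
    refine ne_top_of_le_ne_top ?_ h1
    rw [ENNReal.tsum_mul_left]
    exact ENNReal.mul_ne_top ENNReal.coe_ne_top hBsum
  -- `a` and every `h i` have integral zero, and the series `a - g = ∑ h i` may be integrated
  -- termwise.
  have hg0 : ∫ x, g x ∂μ = 0 := by
    have h1 : Summable fun i => ∫ x, ‖h i x‖ ∂μ := by
      refine (ENNReal.summable_toReal hL1).congr fun i => ?_
      rw [eLpNorm_one_eq_lintegral_enorm, integral_norm_eq_lintegral_enorm (hhI i).1]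
    have h2 := hasSum_integral_of_summable_integral_norm hhI h1
    simp only [fun i => (hh i).2.2.2.1, fun x => (hpt x).tsum_eq] at h2
    have h3 := h2.unique hasSum_zero
    rw [integral_sub haI hgI, haint, zero_sub, neg_eq_zero] at h3
    exact h3
  let lam : u → ℝ := fun i => atomFactor μ p c (B i)
  have hlam : ∀ i, 0 < lam i := fun i => hμ.atomFactor_pos hc0 _
  let κ : ℝ := atomFactor μ p c B₀.enlarge
  have hκ : 0 < κ := hμ.atomFactor_pos hc0 _
  have hatom : ∀ i, atomClass μ D p q ((lam i : ℂ)⁻¹ • h i) := fun i =>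
    .inl ⟨B i, hμ.isSizedOn_inv_smul (hh i).1 (hh i).2.1 hc0 (hh i).2.2.2.2, by
      simp only [Pi.smul_apply]
      rw [integral_smul, (hh i).2.2.2.1, smul_zero]⟩
  have hgatom : atomClass μ D p ∞ ((κ : ℂ)⁻¹ • g) :=
    .inl ⟨B₀.enlarge, hμ.isSizedOn_inv_smul hgm hgs hc0 (by simpa using hgn), by
      simp only [Pi.smul_apply]
      rw [integral_smul, hg0, smul_zero]⟩
  choose T hT using fun i => hR.exists_of_atomClass q hq1 _ (hatom i)
  obtain ⟨G, hG⟩ := hR.exists_of_atomClass ∞ le_top _ hgatom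
  have hT' : ∀ i, R (h i) ((lam i : ℂ) • T i) := fun i => by
    have := hR.smul (lam i) _ _ (hT i)
    rwa [smul_inv_smul₀ (Complex.ofReal_ne_zero.2 (hlam i).ne')] at this
  have hG' : R g ((κ : ℂ) • G) := by
    have := hR.smul κ _ _ hG
    rwa [smul_inv_smul₀ (Complex.ofReal_ne_zero.2 hκ.ne')] at this
  have hnorm : ∀ i, ‖(lam i : ℂ)‖ ^ p = (c : ℝ) ^ p * μ.real (B i).toSet := fun i => by
    rw [Complex.norm_real, Real.norm_of_nonneg (hlam i).le]
    exact atomFactor_rpow hp0 c (B i)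
  have hlams : Summable fun i => ‖(lam i : ℂ)‖ ^ p := by
    simp only [hnorm]
    exact hBs.mul_left _
  have hTs : Summable fun i => (lam i : ℂ) • T i := by
    refine Summable.of_norm_bounded
      (summable_of_summable_rpow hp0 hp1 (fun i => norm_nonneg _) hlams) fun i => ?_
    rw [norm_smul]
    exact mul_le_of_le_one_right (norm_nonneg _) (hR.norm_le q hq1 _ _ (hatom i) (hT i))
  have hres : HasSum (fun i => (lam i : ℂ) • T i) (S - (κ : ℂ) • G) :=
    hR.hasSum u B₀.enlarge h (a - g) _ _ (fun i => (hh i).2.2.1) hhI hL1 hpt hT'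
      (hR.sub B₀.enlarge a g _ _ (hasupp.trans B₀.toSet_subset_enlarge) hgs haI hgI haS hG') hTs
  refine ⟨(κ : ℂ) • G, S - (κ : ℂ) • G, (add_sub_cancel _ _).symm, ?_, ?_⟩
  · refine (HasDecomp.of_atom hp0 (.inr (.inr rfl)) hR.zero hgatom hG κ).mono ?_
    have hE : μ.real B₀.enlarge.toSet ≤ K * μ.real B₀.toSet := by
      have h1 := ENNReal.toReal_mono (ENNReal.mul_ne_top ENNReal.coe_ne_top hVt) (hKB B₀)
      rwa [ENNReal.toReal_mul] at h1
    rw [Complex.norm_real, Real.norm_of_nonneg hκ.le]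
    calc κ ^ p = (c : ℝ) ^ p * μ.real B₀.enlarge.toSet := atomFactor_rpow hp0 c _
      _ ≤ (c : ℝ) ^ p * (K * μ.real B₀.toSet) := by gcongr
      _ = ((K : ℝ) * N) ^ p * ((M : ℝ) ^ p * μ.real B₀.toSet) * K := by
        rw [hc]
        push_cast
        rw [Real.mul_rpow (by positivity) (by positivity)]
        ring
      _ = _ := by rw [hMV]
  · refine HasDecomp.of_countable hp0 (.inr (.inr rfl)) hR.zero (fun i => (lam i : ℂ)) _ T
      (fun i => ⟨hatom i, hT i⟩) hlams ?_ hres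
    simp only [hnorm]
    rw [tsum_mul_left]
    have hNpos : (0 : ℝ) < N := NNReal.coe_pos.2 (pos_iff_ne_zero.2 hN0)
    have hBle' : ∑' i, μ.real (B i).toSet ≤ (N : ℝ) ^ (-q.toReal) * (K * μ.real B₀.toSet) := by
      rw [Real.rpow_neg hNpos.le, ← div_eq_inv_mul, le_div_iff₀' (by positivity)]
      exact hBle
    calc (c : ℝ) ^ p * ∑' i, μ.real (B i).toSet
        ≤ (c : ℝ) ^ p * ((N : ℝ) ^ (-q.toReal) * (K * μ.real B₀.toSet)) := by gcongr
      _ = (K : ℝ) ^ p * ((M : ℝ) ^ p * μ.real B₀.toSet) * K *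
            ((N : ℝ) ^ p * (N : ℝ) ^ (-q.toReal)) := by
        rw [hc]
        push_cast
        rw [Real.mul_rpow (by positivity) (by positivity),
          Real.mul_rpow (by positivity) (by positivity)]
        ring
      _ = (K : ℝ) ^ p * 2 ^ p * K * (N : ℝ) ^ (-(q.toReal - p)) := by
        rw [hMV, ← Real.rpow_add hNpos]
        congr 2
        ring
      _ ≤ 1 / 2 := hN

theorem IsRealization.exists_split [CompleteSpace E] [T2Space E] [BorelSpace X]
    (hR : IsRealization R μ D p) (hμ : IsSpaceOfHomogeneousType μ) (hp0 : 0 < p) (hp1 : p ≤ 1)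
    {q : ℝ≥0∞} (hq1 : 1 ≤ q) (hqt : q ≠ ∞) (hpq : p < q.toReal) :
    ∃ K : ℝ, 0 ≤ K ∧ ∀ (a : X → ℂ) (S : E), atomClass μ D p q a → R a S →
      ∃ S₁ S₂, S = S₁ + S₂ ∧ HasDecomp R (atomClass μ D p ∞) p S₁ K ∧
        HasDecomp R (atomClass μ D p q) p S₂ (1 / 2) := by
  obtain ⟨K, hK0, hK⟩ := hR.exists_split_of_integral_eq_zero hμ hp0 hp1 hq1 hqt hpq
  refine ⟨1 + K, by positivity, fun a S ha haS => ?_⟩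
  have hzero : ∀ q, atomClass μ D p q 0 := fun q => .inr (.inr rfl)
  rcases ha with ⟨B, hB, hint⟩ | ⟨B, hBD, hB⟩ | rfl
  · obtain ⟨S₁, S₂, h, h1, h2⟩ := hK B a S hB.aestronglyMeasurable hB.support_subset hint
      (hB.eLpNorm_le.trans (le_mul_of_one_le_left bot_le one_le_two)) haS
    exact ⟨S₁, S₂, h, h1.mono (by linarith), h2⟩
  · have hV0 := hμ.measure_toSet_ne_zero B
    have hVt := hμ.measure_toSet_ne_top B
    have hVpos := hμ.measureReal_toSet_pos B
    have hBm := B.measurableSet_toSet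
    have haI := hB.integrable hμ hq1
    -- The mean of `a` over `B`. Subtracting it on `B` at most doubles the size bound, hence the
    -- factor 2 allowed in the mean-zero case.
    let c : ℂ := ((μ.real B.toSet)⁻¹ : ℝ) • ∫ x, a x ∂μ
    have hc : ‖c‖ₑ ≤ μ B.toSet ^ (-(1 / p)) := by
      simp only [c]
      rw [Measure.real, enorm_smul, Real.enorm_of_nonneg (by positivity),
        ENNReal.ofReal_inv_of_pos (ENNReal.toReal_pos hV0 hVt), ENNReal.ofReal_toReal hVt]
      calc (μ B.toSet)⁻¹ * ‖∫ x, a x ∂μ‖ₑ ≤ (μ B.toSet)⁻¹ * μ B.toSet ^ (1 - 1 / p) := by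
            gcongr
            refine (enorm_integral_le_lintegral_enorm _).trans ?_
            rw [← eLpNorm_one_eq_lintegral_enorm]
            exact hB.eLpNorm_one_le hμ hq1
        _ = μ B.toSet ^ (-(1 / p)) := by
            rw [← ENNReal.rpow_neg_one, ← ENNReal.rpow_add _ _ hV0 hVt]
            congr 1
            ring
    let b : X → ℂ := B.toSet.indicator fun _ => c
    have hbs : IsSizedOn μ p ∞ b B := by
      refine ⟨aestronglyMeasurable_const.indicator hBm, Set.support_indicator_subset, ?_⟩
      refine (eLpNorm_indicator_const_le c ∞).trans ?_
      simpa using hc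
    have hba : atomClass μ D p ∞ b := .inr (.inl ⟨B, hBD, hbs⟩)
    have hbI := hbs.integrable hμ le_top
    obtain ⟨T, hT⟩ := hR.exists_of_atomClass ∞ le_top b hba
    have hsub : R (a - b) (S - T) :=
      hR.sub B a b S T hB.support_subset hbs.support_subset haI hbI haS hT
    obtain ⟨S₁, S₂, h, h1, h2⟩ := hK B (a - b) (S - T)
      (hB.aestronglyMeasurable.sub hbs.aestronglyMeasurable)
      ((Function.support_sub _ _).trans (Set.union_subset hB.support_subset hbs.support_subset))
      (by
        simp only [Pi.sub_apply]
        rw [integral_sub haI hbI, integral_indicator hBm, setIntegral_const, smul_smul,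
          mul_inv_cancel₀ hVpos.ne', one_smul, sub_self])
      (by
        rw [two_mul]
        exact (eLpNorm_sub_le hB.aestronglyMeasurable hbs.aestronglyMeasurable hq1).trans
          (add_le_add hB.eLpNorm_le (hbs.of_top hμ q).eLpNorm_le)) hsub
    refine ⟨T + S₁, S₂, by rw [add_assoc, ← h]; abel, ?_, h2⟩
    refine HasDecomp.add hp0 hp1 (hzero ∞) hR.zero (hR.norm_le ∞ le_top) ?_ h1
    simpa using HasDecomp.of_atom hp0 (hzero ∞) hR.zero hba hT 1
  -- `IsRealization` does not assert that only `0` represents the zero function, so `S` is kept as a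
  -- single term with coefficient 1.
  · refine ⟨(1 : ℂ) • S, (0 : ℂ) • S, by simp, ?_, ?_⟩
    · exact (HasDecomp.of_atom hp0 (hzero ∞) hR.zero (hzero ∞) haS 1).mono (by simpa using hK0)
    · exact (HasDecomp.of_atom hp0 (hzero q) hR.zero (hzero q) haS 0).mono
        (by simp [Real.zero_rpow hp0.ne'])

end Realization

/-! ### Comparison of the atomic spaces and their norms. -/

section AtomicSpace

variable {X : Type u} [MetricSpace X] [MeasurableSpace X]
  {E : Type*} [SeminormedAddCommGroup E] [NormedSpace ℂ E]
  {R : (X → ℂ) → E → Prop} {μ : Measure X} {D : Set (MetricBall X)} {p : ℝ}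

/-- Both series converge absolutely, so the limit of their joint partial sums is the sum of two
unordered sums, which merge into one series. -/
theorem IsAtomicDecomposition.hasDecomp [CompleteSpace E] [T2Space E]
    (hR : IsRealization R μ D p) (hp0 : 0 < p) (hp1 : p ≤ 1) {q : ℝ≥0∞} (hq : 1 ≤ q) {f : E}
    {lam nu : ℕ → ℂ} (h : IsAtomicDecomposition R μ D p q f lam nu) :
    HasDecomp R (atomClass μ D p q) p f (∑' j, ‖lam j‖ ^ p + ∑' k, ‖nu k‖ ^ p) := by
  obtain ⟨hlam, hnu, a, b, S, T, ha, hb, hlim⟩ := h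
  have ha' : ∀ j, atomClass μ D p q (a j) ∧ R (a j) (S j) := fun j =>
    ⟨(ha j).1.elim .inl fun h => .inr (.inr h), (ha j).2⟩
  have hb' : ∀ j, atomClass μ D p q (b j) ∧ R (b j) (T j) := fun j => ⟨.inr (hb j).1, (hb j).2⟩
  have hs : ∀ (c : ℕ → ℂ) (e : ℕ → X → ℂ) (U : ℕ → E), (Summable fun j => ‖c j‖ ^ p) →
      (∀ j, atomClass μ D p q (e j) ∧ R (e j) (U j)) → Summable fun j => c j • U j := by
    intro c e U hc he
    refine Summable.of_norm_bounded
      (summable_of_summable_rpow hp0 hp1 (fun j => norm_nonneg (c j)) hc) fun j => ?_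
    rw [norm_smul]
    exact mul_le_of_le_one_right (norm_nonneg _) (hR.norm_le q hq _ _ (he j).1 (he j).2)
  have h1 := (hs lam a S hlam ha').hasSum
  have h2 := (hs nu b T hnu hb').hasSum
  rw [tendsto_nhds_unique hlim (h1.tendsto_sum_nat.add h2.tendsto_sum_nat)]
  exact HasDecomp.add hp0 hp1 (.inr (.inr rfl)) hR.zero (hR.norm_le q hq)
    ⟨lam, a, S, ha', hlam, le_rfl, h1⟩ ⟨nu, b, T, hb', hnu, le_rfl, h2⟩

/-- Each term goes to the local series if its function is a local atom and to the other one if not;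
`0` fills the vacated place. -/
theorem HasDecomp.exists_isAtomicDecomposition (hR : IsRealization R μ D p) (hp0 : 0 < p)
    {q : ℝ≥0∞} {f : E} {t : ℝ} (h : HasDecomp R (atomClass μ D p q) p f t) :
    ∃ lam nu : ℕ → ℂ, IsAtomicDecomposition R μ D p q f lam nu ∧
      ∑' j, ‖lam j‖ ^ p + ∑' k, ‖nu k‖ ^ p ≤ t := by
  classical
  obtain ⟨lam, a, S, ha, hs, ht, hf⟩ := h
  let L : ℕ → Prop := fun j => IsLocalAtom μ D p q (a j)
  let l₁ : ℕ → ℂ := fun j => if L j then 0 else lam j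
  let l₂ : ℕ → ℂ := fun j => if L j then lam j else 0
  have hl : ∀ j, ‖l₁ j‖ ^ p + ‖l₂ j‖ ^ p = ‖lam j‖ ^ p := fun j => by
    by_cases hj : L j <;> simp [l₁, l₂, hj, Real.zero_rpow hp0.ne']
  have h1 : Summable fun j => ‖l₁ j‖ ^ p := Summable.of_nonneg_of_le
    (fun j => by positivity) (fun j => by rw [← hl j]; exact le_add_of_nonneg_right (by positivity)) hs
  have h2 : Summable fun j => ‖l₂ j‖ ^ p := Summable.of_nonneg_of_le
    (fun j => by positivity) (fun j => by rw [← hl j]; exact le_add_of_nonneg_left (by positivity)) hs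
  refine ⟨l₁, l₂, ⟨h1, h2, fun j => if L j then 0 else a j, fun j => if L j then a j else 0,
    fun j => if L j then 0 else S j, fun j => if L j then S j else 0, fun j => ?_, fun j => ?_, ?_⟩, ?_⟩
  · by_cases hj : L j
    · simpa [hj] using hR.zero
    · simp only [hj, if_false]
      exact ⟨(ha j).1.elim .inl fun h => .inr (h.resolve_left hj), (ha j).2⟩
  · by_cases hj : L j
    · simpa only [hj, if_true] using ⟨.inl hj, (ha j).2⟩
    · simpa [hj] using hR.zero
  · refine hf.tendsto_sum_nat.congr fun N => ?_
    rw [← Finset.sum_add_distrib]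
    refine Finset.sum_congr rfl fun j _ => ?_
    by_cases hj : L j <;> simp [l₁, l₂, hj]
  · rw [← h1.tsum_add h2]
    simpa only [hl] using ht

theorem atomicSpace_subset_and_norm_le [CompleteSpace E] [T2Space E]
    (hR : IsRealization R μ D p) (hp0 : 0 < p) (hp1 : p ≤ 1) {q q' : ℝ≥0∞} (hq : 1 ≤ q)
    {C : ℝ} (hC : 0 < C)
    (h : ∀ f t, HasDecomp R (atomClass μ D p q) p f t →
      HasDecomp R (atomClass μ D p q') p f (C * t)) :
    atomicSpace R μ D p q ⊆ atomicSpace R μ D p q' ∧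
      ∀ f ∈ atomicSpace R μ D p q,
        atomicNorm R μ D p q' f ≤ C ^ (1 / p) * atomicNorm R μ D p q f := by
  have key : ∀ (f : E) (lam nu : ℕ → ℂ), IsAtomicDecomposition R μ D p q f lam nu →
      ∃ lam' nu' : ℕ → ℂ, IsAtomicDecomposition R μ D p q' f lam' nu' ∧
        ∑' j, ‖lam' j‖ ^ p + ∑' k, ‖nu' k‖ ^ p
          ≤ C * (∑' j, ‖lam j‖ ^ p + ∑' k, ‖nu k‖ ^ p) := fun f lam nu hf =>
    (h _ _ (hf.hasDecomp hR hp0 hp1 hq)).exists_isAtomicDecomposition hR hp0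
  have hnn : ∀ lam nu : ℕ → ℂ, 0 ≤ ∑' j, ‖lam j‖ ^ p + ∑' k, ‖nu k‖ ^ p := fun lam nu =>
    add_nonneg (tsum_nonneg fun j => by positivity) (tsum_nonneg fun j => by positivity)
  refine ⟨fun f ⟨lam, nu, hf⟩ => ?_, fun f ⟨lam, nu, hf⟩ => ?_⟩
  · obtain ⟨lam', nu', hf', -⟩ := key f lam nu hf
    exact ⟨lam', nu', hf'⟩
  · rw [← div_le_iff₀' (by positivity)]
    refine le_csInf ⟨_, lam, nu, hf, rfl⟩ ?_
    rintro t ⟨lam, nu, hf, rfl⟩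
    rw [div_le_iff₀' (by positivity), ← Real.mul_rpow hC.le (hnn lam nu)]
    obtain ⟨lam', nu', hf', hle⟩ := key f lam nu hf
    refine le_trans (csInf_le ⟨0, ?_⟩ ⟨lam', nu', hf', rfl⟩)
      (Real.rpow_le_rpow (hnn lam' nu') hle (by positivity))
    rintro s ⟨lam, nu, -, rfl⟩
    exact Real.rpow_nonneg (hnn lam nu) _

theorem atomClass_of_top (hμ : IsSpaceOfHomogeneousType μ) {a : X → ℂ}
    (h : atomClass μ D p ∞ a) (q : ℝ≥0∞) : atomClass μ D p q a := by
  rcases h with ⟨B, hB, h⟩ | ⟨B, hBD, hB⟩ | h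
  · exact .inl ⟨B, hB.of_top hμ q, h⟩
  · exact .inr (.inl ⟨B, hBD, hB.of_top hμ q⟩)
  · exact .inr (.inr h)

/-- For every realization of the atoms the atomic spaces with exponents `q < ∞` and `∞` coincide,
with equivalent norms. -/
theorem IsRealization.atomicSpace_eq_and_norm_equiv [CompleteSpace E] [T2Space E] [BorelSpace X]
    (hR : IsRealization R μ D p) (hμ : IsSpaceOfHomogeneousType μ) (hp0 : 0 < p) (hp1 : p ≤ 1)
    {q : ℝ≥0∞} (hq1 : 1 ≤ q) (hqt : q ≠ ∞) (hpq : p < q.toReal) :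
    atomicSpace R μ D p q = atomicSpace R μ D p ∞ ∧ ∃ C : ℝ, 0 < C ∧
      ∀ f ∈ atomicSpace R μ D p ∞,
        atomicNorm R μ D p q f ≤ C * atomicNorm R μ D p ∞ f ∧
        atomicNorm R μ D p ∞ f ≤ C * atomicNorm R μ D p q f := by
  obtain ⟨K, hK, hsplit⟩ := hR.exists_split hμ hp0 hp1 hq1 hqt hpq
  have hzero : ∀ q, atomClass μ D p q 0 := fun q => .inr (.inr rfl)
  have hnn : ∀ q (f : E), 0 ≤ atomicNorm R μ D p q f := by
    refine fun q f => Real.sInf_nonneg ?_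
    rintro s ⟨lam, nu, -, rfl⟩
    exact Real.rpow_nonneg (add_nonneg (tsum_nonneg fun j => by positivity)
      (tsum_nonneg fun j => by positivity)) _
  obtain ⟨hsub, hle⟩ := atomicSpace_subset_and_norm_le (q := q) (q' := ∞) (C := 2 * K + 1)
    hR hp0 hp1 hq1 (by positivity) (by
      intro f t hf
      have h := HasDecomp.of_forall_split hp0 hp1 (hzero q) (hzero ∞) hR.zero (hR.norm_le q hq1)
        (hR.norm_le ∞ le_top) hK hsplit hf
      refine h.mono ?_
      obtain ⟨lam, a, S, -, -, ht, -⟩ := hf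
      have ht0 : 0 ≤ t := (tsum_nonneg fun j => by positivity).trans ht
      linarith)
  obtain ⟨hsub', hle'⟩ := atomicSpace_subset_and_norm_le (q := ∞) (q' := q) (C := 1)
    hR hp0 hp1 le_top one_pos (by
      rintro f t ⟨lam, a, S, h, h'⟩
      rw [one_mul]
      exact ⟨lam, a, S, fun j => ⟨atomClass_of_top hμ (h j).1 q, (h j).2⟩, h'⟩)
  have hC : (1 : ℝ) ≤ (2 * K + 1) ^ (1 / p) := Real.one_le_rpow (by linarith) (by positivity)
  refine ⟨hsub.antisymm hsub', (2 * K + 1) ^ (1 / p), by positivity, fun f hf => ⟨?_, ?_⟩⟩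
  · refine (hle' f hf).trans ?_
    rw [Real.one_rpow]
    exact mul_le_mul_of_nonneg_right hC (hnn _ _)
  · exact hle f (hsub' hf)

end AtomicSpace

/-! ### Atoms as elements of `L¹`. -/

section RealizationL1

variable {X : Type u} [MetricSpace X] [MeasurableSpace X] {μ : Measure X}

theorem isRealization_representsL1 (hμ : IsSpaceOfHomogeneousType μ) (D : Set (MetricBall X)) :
    IsRealization (RepresentsL1 μ) μ D 1 where
  zero := Lp.coeFn_zero _ _ _
  exists_of_atomClass q hq a ha := by
    have hI : Integrable a μ := by
      rcases ha with ⟨B, hB, -⟩ | ⟨B, -, hB⟩ | rfl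
      · exact hB.integrable hμ hq
      · exact hB.integrable hμ hq
      · exact integrable_zero _ _ _
    exact ⟨(memLp_one_iff_integrable.2 hI).toLp a, MemLp.coeFn_toLp _⟩
  norm_le q hq a S ha haS := by
    have h1 : eLpNorm a 1 μ ≤ 1 := by
      rcases ha with ⟨B, hB, -⟩ | ⟨B, -, hB⟩ | rfl
      · simpa using hB.eLpNorm_one_le hμ hq
      · simpa using hB.eLpNorm_one_le hμ hq
      · simp
    rw [Lp.norm_def, eLpNorm_congr_ae haS]
    simpa using ENNReal.toReal_mono ENNReal.one_ne_top h1
  smul c a S h := (Lp.coeFn_smul c S).trans (h.const_smul c)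
  sub B a b S T _ _ _ _ hS hT := (Lp.coeFn_sub S T).trans (hS.sub hT)
  hasSum ι _ B h a S T _ _ hL1 hsum hS hT hsm := by
    have hn : ∑' i, ‖S i‖ₑ ≠ ∞ := by
      convert hL1 using 3 with i
      rw [Lp.enorm_def]
      exact eLpNorm_congr_ae (hS i)
    -- Summability of the norms gives convergence almost everywhere as well, which identifies the
    -- `L¹` sum with the pointwise one.
    have hae := Lp.hasSum_coeFn_tsum hn
    have heq : T = ∑' i, S i := by
      refine Lp.ext ?_
      filter_upwards [hae, hT, eventually_countable_forall.2 hS] with x hx hTx hSx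
      simp only [hSx] at hx
      rw [hTx]
      exact (hsum x).unique hx
    rw [heq]
    exact hsm.hasSum

end RealizationL1

/-! ### Atoms as functionals on the localized Lipschitz space. -/

section RealizationDual

variable {X : Type u} [MetricSpace X] [MeasurableSpace X] {μ : Measure X}
  {D : Set (MetricBall X)} {α : ℝ}

theorem LipD.aestronglyMeasurable (g : LipD μ D α) : AEStronglyMeasurable g.toFun μ := g.2.1

theorem LipD.toFun_add (f g : LipD μ D α) : (f + g).toFun = f.toFun + g.toFun := rfl

theorem LipD.toFun_smul (c : ℂ) (f : LipD μ D α) : (c • f).toFun = c • f.toFun := rfl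

/-- On a ball `B` a function in the localized Lipschitz space is close to a constant, which can be
taken to be `0` if `B ∈ D`. -/
theorem IsLipBound.exists_ae_norm_sub_le [BorelSpace X] {f : X → ℂ} {C : ℝ}
    (h : IsLipBound μ D α f C) (B : MetricBall X) :
    ∃ z : ℂ, (B ∈ D → z = 0) ∧ ∀ᵐ x ∂μ, x ∈ B.toSet → ‖f x - z‖ ≤ C * μ.real B.toSet ^ α := by
  by_cases hB : B ∈ D
  · refine ⟨0, fun _ => rfl, ?_⟩
    rw [← ae_restrict_iff' B.measurableSet_toSet]
    have h1 := h.bdd B hB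
    rw [eLpNorm_exponent_top] at h1
    filter_upwards [ae_le_eLpNormEssSup (f := f) (μ := μ.restrict B.toSet)] with x hx
    have h2 := hx.trans h1
    rw [← ofReal_norm, ENNReal.ofReal_le_ofReal_iff
      (mul_nonneg h.nonneg (Real.rpow_nonneg measureReal_nonneg _))] at h2
    simpa using h2
  · exact ⟨f B.center, fun h => absurd h hB, Eventually.of_forall fun x hx =>
      h.osc B hB x hx _ (Metric.mem_ball_self B.radius_pos)⟩

theorem LipD.exists_ae_norm_le [BorelSpace X] (g : LipD μ D α) (B : MetricBall X) :
    ∃ K : ℝ, ∀ᵐ x ∂μ, x ∈ B.toSet → ‖g.toFun x‖ ≤ K := by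
  obtain ⟨C, hC⟩ := g.2.2
  obtain ⟨z, -, hz⟩ := hC.exists_ae_norm_sub_le B
  refine ⟨‖z‖ + C * μ.real B.toSet ^ α, ?_⟩
  filter_upwards [hz] with x hx hxB
  have h := norm_add_le z (g.toFun x - z)
  rw [add_sub_cancel] at h
  exact h.trans (add_le_add le_rfl (hx hxB))

theorem norm_mul_le_of_support_subset {X : Type*} [MeasurableSpace X] {μ : Measure X}
    {s : Set X} {a f : X → ℂ} (hs : Function.support a ⊆ s)
    {K : ℝ} (hf : ∀ᵐ x ∂μ, x ∈ s → ‖f x‖ ≤ K) : ∀ᵐ x ∂μ, ‖a x * f x‖ ≤ K * ‖a x‖ := by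
  filter_upwards [hf] with x hx
  rw [norm_mul, mul_comm]
  by_cases h0 : a x = 0
  · simp [h0]
  · exact mul_le_mul_of_nonneg_right (hx (hs h0)) (norm_nonneg _)

theorem LipD.integrable_mul [BorelSpace X] (g : LipD μ D α) {a : X → ℂ} (ha : Integrable a μ)
    {B : MetricBall X} (hs : Function.support a ⊆ B.toSet) :
    Integrable (fun x => a x * g.toFun x) μ := by
  obtain ⟨K, hK⟩ := g.exists_ae_norm_le B
  exact (ha.norm.const_mul K).mono' (ha.1.mul g.aestronglyMeasurable)
    (norm_mul_le_of_support_subset hs hK)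

/-- Replacing `g` by `g - z` does not change the integral: either `a` has mean zero, or the ball is
in `D` and `z = 0`. Then `|g - z| ≤ C μ(B)^{1/p-1}` on `B`, and `‖a‖_1 ≤ μ(B)^{1-1/p}` cancels this
power. -/
theorem IsSizedOn.norm_integral_mul_le [BorelSpace X] (hμ : IsSpaceOfHomogeneousType μ) {p : ℝ}
    {q : ℝ≥0∞} (hq : 1 ≤ q) {a : X → ℂ} {B : MetricBall X} (h : IsSizedOn μ p q a B)
    (h0 : ∫ x, a x ∂μ = 0 ∨ B ∈ D) (g : LipD μ D (1 / p - 1)) :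
    ‖∫ x, a x * g.toFun x ∂μ‖ ≤ ‖g‖ := by
  have hV := hμ.measureReal_toSet_pos B
  have haI := h.integrable hμ hq
  rw [LipD.norm_def]
  refine le_csInf g.2.2 fun C hC => ?_
  obtain ⟨z, hzD, hz⟩ := IsLipBound.exists_ae_norm_sub_le hC B
  have heq : ∫ x, a x * g.toFun x ∂μ = ∫ x, a x * (g.toFun x - z) ∂μ := by
    simp only [mul_sub]
    rw [integral_sub (g.integrable_mul haI h.support_subset) (haI.mul_const z),
      integral_mul_const]
    rcases h0 with h0 | h0
    · rw [h0, zero_mul, sub_zero]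
    · rw [hzD h0, mul_zero, sub_zero]
  have hn : ∫ x, ‖a x‖ ∂μ ≤ μ.real B.toSet ^ (1 - 1 / p) := by
    rw [integral_norm_eq_lintegral_enorm haI.1, ← eLpNorm_one_eq_lintegral_enorm, Measure.real,
      ENNReal.toReal_rpow]
    refine ENNReal.toReal_mono ?_ (h.eLpNorm_one_le hμ hq)
    simp [ENNReal.rpow_eq_top_iff, hμ.measure_toSet_ne_zero B, hμ.measure_toSet_ne_top B]
  calc ‖∫ x, a x * g.toFun x ∂μ‖
      ≤ ∫ x, C * μ.real B.toSet ^ (1 / p - 1) * ‖a x‖ ∂μ := by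
        rw [heq]
        exact norm_integral_le_of_norm_le (haI.norm.const_mul _)
          (norm_mul_le_of_support_subset h.support_subset hz)
    _ ≤ C * μ.real B.toSet ^ (1 / p - 1) * μ.real B.toSet ^ (1 - 1 / p) := by
        rw [integral_const_mul]
        exact mul_le_mul_of_nonneg_left hn (mul_nonneg hC.nonneg (Real.rpow_nonneg hV.le _))
    _ = C := by
        rw [mul_assoc, ← Real.rpow_add hV]
        simp

theorem isRealization_representsDual [BorelSpace X] (hμ : IsSpaceOfHomogeneousType μ)
    (D : Set (MetricBall X)) (p : ℝ) :
    IsRealization (RepresentsDual μ D (1 / p - 1)) μ D p where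
  zero g := by simp
  exists_of_atomClass q hq a ha := by
    have key : ∀ B : MetricBall X, IsSizedOn μ p q a B → (∫ x, a x ∂μ = 0 ∨ B ∈ D) →
        ∃ S, RepresentsDual μ D (1 / p - 1) a S := by
      intro B hB h0
      have haI := hB.integrable hμ hq
      let L : LipD μ D (1 / p - 1) →ₗ[ℂ] ℂ :=
        { toFun := fun g => ∫ x, a x * g.toFun x ∂μ
          map_add' := fun f g => by
            rw [← integral_add (f.integrable_mul haI hB.support_subset)
              (g.integrable_mul haI hB.support_subset)]
            simp only [LipD.toFun_add, Pi.add_apply, mul_add]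
          map_smul' := fun c f => by
            rw [← integral_smul]
            simp only [LipD.toFun_smul, Pi.smul_apply, smul_eq_mul, RingHom.id_apply]
            congr 1
            funext x
            ring }
      exact ⟨L.mkContinuous 1 fun g => by
        rw [one_mul]
        exact hB.norm_integral_mul_le hμ hq h0 g, fun g => rfl⟩
    rcases ha with ⟨B, hB, h0⟩ | ⟨B, hBD, hB⟩ | rfl
    · exact key B hB (.inl h0)
    · exact key B hB (.inr hBD)
    · exact ⟨0, fun g => by simp⟩
  norm_le q hq a S ha haS := by
    refine S.opNorm_le_bound zero_le_one fun g => ?_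
    rw [haS g, one_mul]
    rcases ha with ⟨B, hB, h0⟩ | ⟨B, hBD, hB⟩ | rfl
    · exact hB.norm_integral_mul_le hμ hq (.inl h0) g
    · exact hB.norm_integral_mul_le hμ hq (.inr hBD) g
    · simp
  smul c a S h g := by
    simp only [Pi.smul_apply, smul_eq_mul, mul_assoc]
    rw [integral_const_mul, ← h g]
    rfl
  sub B a b S T ha hb haI hbI hS hT g := by
    simp only [Pi.sub_apply, sub_mul]
    rw [integral_sub (g.integrable_mul haI ha) (g.integrable_mul hbI hb), ← hS g, ← hT g]
    rfl
  hasSum ι _ B h a S T hs hI hL1 hsum hS hT hsm := by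
    have heq : T = ∑' i, S i := by
      refine ContinuousLinearMap.ext fun g => ?_
      have h1 : HasSum (fun i => S i g) ((∑' i, S i) g) :=
        hsm.hasSum.mapL (ContinuousLinearMap.apply ℂ ℂ g)
      obtain ⟨K, hK⟩ := g.exists_ae_norm_le B
      -- All `h i` live on `B`, where `g` is essentially bounded by `K`; the summable `L¹` norms
      -- then justify exchanging sum and integral.
      have h2 : Summable fun i => ∫ x, ‖h i x * g.toFun x‖ ∂μ := by
        have h3 : Summable fun i => K * ∫ x, ‖h i x‖ ∂μ := by
          refine ((ENNReal.summable_toReal hL1).congr fun i => ?_).mul_left K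
          rw [eLpNorm_one_eq_lintegral_enorm, integral_norm_eq_lintegral_enorm (hI i).1]
        refine Summable.of_nonneg_of_le (fun i => integral_nonneg fun x => norm_nonneg _)
          (fun i => ?_) h3
        rw [← integral_const_mul]
        exact integral_mono_ae (g.integrable_mul (hI i) (hs i)).norm ((hI i).norm.const_mul K)
          (norm_mul_le_of_support_subset (hs i) hK)
      have h4 := hasSum_integral_of_summable_integral_norm
        (fun i => g.integrable_mul (hI i) (hs i)) h2
      simp only [fun x => ((hsum x).mul_right (g.toFun x)).tsum_eq] at h4
      simp only [← fun i => hS i g, ← hT g] at h4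
      exact h4.unique h1
    rw [heq]
    exact hsm.hasSum

end RealizationDual

end LocalizedHardy

end

theorem lemma2p5 {X : Type*} [MetricSpace X] [MeasurableSpace X] [BorelSpace X]
    (μ : Measure X) (hμ : LocalizedHardy.IsSpaceOfHomogeneousType μ)
    (D : Set (LocalizedHardy.MetricBall X)) (p : ℝ) (hp0 : 0 < p) (hp1 : p ≤ 1)
    (q : ℝ) (hq1 : 1 ≤ q) (hpq : p < q) :
    (p = 1 →
      LocalizedHardy.hardyOne μ D (ENNReal.ofReal q) = LocalizedHardy.hardyOne μ D ∞ ∧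
      ∃ C : ℝ, 0 < C ∧ ∀ f ∈ LocalizedHardy.hardyOne μ D ∞,
        LocalizedHardy.hardyOneNorm μ D (ENNReal.ofReal q) f ≤
          C * LocalizedHardy.hardyOneNorm μ D ∞ f ∧
        LocalizedHardy.hardyOneNorm μ D ∞ f ≤
          C * LocalizedHardy.hardyOneNorm μ D (ENNReal.ofReal q) f) ∧
    (p < 1 →
      LocalizedHardy.hardyLT μ D p (ENNReal.ofReal q) = LocalizedHardy.hardyLT μ D p ∞ ∧
      ∃ C : ℝ, 0 < C ∧ ∀ f ∈ LocalizedHardy.hardyLT μ D p ∞,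
        LocalizedHardy.hardyLTNorm μ D p (ENNReal.ofReal q) f ≤
          C * LocalizedHardy.hardyLTNorm μ D p ∞ f ∧
        LocalizedHardy.hardyLTNorm μ D p ∞ f ≤
          C * LocalizedHardy.hardyLTNorm μ D p (ENNReal.ofReal q) f) := by
  have hq1' : 1 ≤ ENNReal.ofReal q := by simpa using ENNReal.ofReal_le_ofReal hq1
  have hpq' : p < (ENNReal.ofReal q).toReal := by
    rwa [ENNReal.toReal_ofReal (zero_le_one.trans hq1)]
  refine ⟨?_, fun _ => ?_⟩
  · rintro rfl
    exact (LocalizedHardy.isRealization_representsL1 hμ D).atomicSpace_eq_and_norm_equiv hμ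
      hp0 hp1 hq1' ENNReal.ofReal_ne_top hpq'
  · exact (LocalizedHardy.isRealization_representsDual hμ D p).atomicSpace_eq_and_norm_equiv hμ
      hp0 hp1 hq1' ENNReal.ofReal_ne_top hpq'
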